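/- Let $k$ be a field, $A$ a finitely generated abelian group, and let the diagonalizable group scheme $G=D(A)=\operatorname{Spec} k[A]$ act linearly and faithfully on a finite-dimensional $k$-vector space $V$. Then there are linear coordinates $x_1,\dots,x_n$ on $V$ and a monoid homomorphism $\pi:F'=\mathbb N^n\to A$ such that $x_i$ is a weight vector of weight $\pi(e_i)$; thus $k[V]=k[F']$ and the action is induced from $\pi$. Fix any such coordinates and $\pi$, and let $\pi^{gp}:\mathbb Z^n\to A$ be the induced homomorphism. The torus of $G$ is $T=D(A/A_{tors})$. Counting weights with multiplicity, an action of a torus $D(M)$ with weights $\chi_1,\dots,\chi_n\in M$ *has MSOP* if there is a subset $S\subseteq\{1,\dots,n\}$ such that the $\chi_i\otimes 1$, $i\in S$, are a basis of $M\otimes_{\mathbb Z}\mathbb Q$ and every $\chi_j\otimes 1$ with $j\notin S$ is a linear combination of this basis with coefficients $\le 0$; then $(\chi_i)_{i\in S}$ is an *MSOP basis*. (1) Let $P=\{p\in\mathbb N^n:\pi(p)=0\}$, and assume that $P^{gp}=\ker\pi^{gp}$, i.e. $A=F'^{gp}/P^{gp}$. If the induced action of $T$ on $V$ does not have MSOP,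 then $k[V]^G$ is not a polynomial algebra over $k$. (2) Suppose the action of $T$ has MSOP, and fix an MSOP basis, given by $S$ (for the weights of $x_1,\dots,x_n$, the images of $\pi(e_i)$ in $A/A_{tors}$). Let $F'_0$ be the face of $F'$ generated by the $e_i$ with $i\in S$, and let $B\subseteq A$ be the image of $(F'_0)^{gp}$ under $\pi^{gp}$. Then: (a) $A/B$ is finite. (b) With $D(A/B)$ acting on $k[F'/F'_0]$ through the homomorphism $F'/F'_0\to A/B$ induced by $\pi$, the projection $k[V]=k[F']\to k[F'/F'_0]$ restricts to a bijection, hence an isomorphism of $k$-algebras, $$k[V]^G\;\cong\;k[F'/F'_0]^{D(A/B)}.$$ (c) $\operatorname{Spec}k[F'/F'_0]$ with this action is the linear representation of $D(A/B)$ whose coordinate functions are the classes of the $e_j$, $j\notin S$, each of weight the image of $\pi(e_j)$ in $A/B$. The algebra $k[V]^G$ is polynomial over $k$ if and only if this representation is generated by pseudo-reflections. Here, for a finite group scheme $H$ acting linearly and faithfully on $W$, a subgroup scheme $N\subseteq H$ is a *pseudo-reflection* if $W^N$ has codimension one in $W$, and the action is *generated by pseudo-reflections* if the intersection of all subgroup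 schemes of $H$ that contain every pseudo-reflection is $H$. -/

import Mathlib

open scoped TensorProduct

namespace DiagonalizableCST

noncomputable section

/-! ### Linear representations of affine group schemes -/

/-- A linear action on `V` of the affine group scheme `Spec H` over `k`, given as a (right)
comodule over the Hopf algebra `H`: if `coact v = ∑ vᵢ ⊗ hᵢ` then `g • v = ∑ hᵢ(g) vᵢ`. -/
structure LinRep (k H V : Type*) [Field k] [CommRing H] [HopfAlgebra k H]
    [AddCommGroup V] [Module k V] where
  coact : V →ₗ[k] V ⊗[k] H
  /-- The unit acts trivially. -/
  counit_coact : ∀ v, TensorProduct.rid k V ((Coalgebra.counit (R := k) (A := H)).lTensor V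
    (coact v)) = v
  /-- `(g g') • v = g • (g' • v)`. -/
  coassoc : ∀ v, TensorProduct.assoc k V H H (coact.rTensor H (coact v)) =
    (Coalgebra.comul (R := k) (A := H)).lTensor V (coact v)

namespace LinRep

section General

variable {k H V : Type*} [Field k] [CommRing H] [HopfAlgebra k H] [AddCommGroup V] [Module k V]

/-- The subspace `V^N` fixed by the closed subgroup scheme `N = Spec (H ⧸ I)`, where `I` is a
Hopf ideal of `H`: the vectors `v` whose image in `V ⊗ H ⧸ I` under the coaction is `v ⊗ 1`. -/
def fixedSubspace (ρ : LinRep k H V) (I : Ideal H) : Submodule k V :=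
  LinearMap.eqLocus (((Ideal.Quotient.mkₐ k I).toLinearMap.lTensor V) ∘ₗ ρ.coact)
    ((TensorProduct.mk k V (H ⧸ I)).flip 1)

/-- The action is faithful: a closed subgroup scheme `Spec (H ⧸ I)` acting trivially on `V` is
the trivial subgroup scheme, i.e. `I` is the augmentation ideal. -/
def IsFaithful (ρ : LinRep k H V) : Prop :=
  ∀ I : Ideal H, I.IsHopfIdeal k → ρ.fixedSubspace I = ⊤ →
    I = RingHom.ker (Bialgebra.counitAlgHom k H)

/-- The closed subgroup scheme `N = Spec (H ⧸ I)` is a pseudo-reflection: `V^N` has codimension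
one in `V`. -/
def IsPseudoReflection (ρ : LinRep k H V) (I : Ideal H) : Prop :=
  I.IsHopfIdeal k ∧ Module.finrank k (ρ.fixedSubspace I) + 1 = Module.finrank k V

/-- The ideal of the subgroup scheme generated by the pseudo-reflections, i.e. of the
intersection of all closed subgroup schemes `Spec (H ⧸ K)` that contain every pseudo-reflection
(containment of closed subgroup schemes reverses the order on ideals, and the ideal of an
intersection is the sum of the ideals). -/
def pseudoReflectionIdeal (ρ : LinRep k H V) : Ideal H :=
  sSup {K : Ideal H | K.IsHopfIdeal k ∧ ∀ I : Ideal H, ρ.IsPseudoReflection I → K ≤ I}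

/-- The action is generated by pseudo-reflections: the subgroup scheme generated by the
pseudo-reflections is the whole group scheme. -/
def IsGeneratedByPseudoReflections (ρ : LinRep k H V) : Prop :=
  ρ.pseudoReflectionIdeal = ⊥

/-- The restriction of an action of `Spec H` along a morphism of group schemes
`Spec H' → Spec H`. -/
def res {H' : Type*} [CommRing H'] [HopfAlgebra k H'] (ρ : LinRep k H V) (f : H →ₐc[k] H') :
    LinRep k H' V where
  coact := (f : H →ₗ[k] H').lTensor V ∘ₗ ρ.coact
  counit_coact v := by
    rw [LinearMap.comp_apply, ← LinearMap.comp_apply, ← LinearMap.lTensor_comp]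
    have : (Coalgebra.counit (R := k) (A := H')) ∘ₗ (f : H →ₗ[k] H') =
        Coalgebra.counit (R := k) (A := H) := by ext; simp
    rw [this]; exact ρ.counit_coact v
  coassoc v := by
    have h := congrArg (TensorProduct.map (LinearMap.id : V →ₗ[k] V)
      (TensorProduct.map (f : H →ₗ[k] H') (f : H →ₗ[k] H'))) (ρ.coassoc v)
    have hf : (Coalgebra.comul (R := k) (A := H')) ∘ₗ (f : H →ₗ[k] H') =
        TensorProduct.map (f : H →ₗ[k] H') (f : H →ₗ[k] H') ∘ₗ
          Coalgebra.comul (R := k) (A := H) := by ext; simp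
    have hr : ∀ z : V ⊗[k] H,
        (Coalgebra.comul (R := k) (A := H')).lTensor V ((f : H →ₗ[k] H').lTensor V z) =
        TensorProduct.map (LinearMap.id : V →ₗ[k] V)
          (TensorProduct.map (f : H →ₗ[k] H') (f : H →ₗ[k] H'))
          ((Coalgebra.comul (R := k) (A := H)).lTensor V z) := fun z => by
      rw [← LinearMap.comp_apply, ← LinearMap.lTensor_comp, hf, LinearMap.lTensor_comp]; rfl
    have hl : ∀ z : V ⊗[k] H,
        TensorProduct.assoc k V H' H' (((f : H →ₗ[k] H').lTensor V ∘ₗ ρ.coact).rTensor H'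
          ((f : H →ₗ[k] H').lTensor V z)) =
        TensorProduct.map (LinearMap.id : V →ₗ[k] V)
          (TensorProduct.map (f : H →ₗ[k] H') (f : H →ₗ[k] H'))
          (TensorProduct.assoc k V H H (ρ.coact.rTensor H z)) := fun z => by
      induction z with
      | zero => simp
      | add a b ha hb => simp only [map_add, ha, hb]
      | tmul u a =>
        simp only [LinearMap.lTensor_tmul, LinearMap.rTensor_tmul, LinearMap.comp_apply]
        induction ρ.coact u with
        | zero => simp
        | add a b ha hb => simp only [map_add, TensorProduct.add_tmul, ha, hb]
        | tmul w b => simp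
    rw [LinearMap.comp_apply, hl, hr]
    exact h

/-- The action on linear forms, `φ ↦ ((g, v) ↦ φ (g • v))`, as a map `V^* → V^* ⊗ H`. -/
def dualCoact [FiniteDimensional k V] (ρ : LinRep k H V) :
    Module.Dual k V →ₗ[k] Module.Dual k V ⊗[k] H :=
  (dualTensorHomEquiv k V H).symm.toLinearMap ∘ₗ
    { toFun := fun φ => (TensorProduct.lid k H).toLinearMap ∘ₗ φ.rTensor H ∘ₗ ρ.coact
      map_add' := fun φ ψ => by simp [LinearMap.rTensor_add, LinearMap.add_comp, LinearMap.comp_add]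
      map_smul' := fun c φ => by
        simp [LinearMap.rTensor_smul, LinearMap.smul_comp, LinearMap.comp_smul] }

end General

end LinRep

/-- The coordinate ring `k[V]` of a vector space: the symmetric algebra of the dual space. -/
abbrev CoordRing (k V : Type*) [Field k] [AddCommGroup V] [Module k V] : Type _ :=
  SymmetricAlgebra k (Module.Dual k V)

namespace LinRep

section General

variable {k H V : Type*} [Field k] [CommRing H] [HopfAlgebra k H] [AddCommGroup V] [Module k V]
  [FiniteDimensional k V]

/-- The comorphism `k[V] → k[V] ⊗ H` of the action morphism `Spec H × V → V`. -/
def coordCoact (ρ : LinRep k H V) : CoordRing k V →ₐ[k] CoordRing k V ⊗[k] H :=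
  SymmetricAlgebra.lift ((SymmetricAlgebra.ι k (Module.Dual k V)).rTensor H ∘ₗ ρ.dualCoact)

/-- The ring of invariants `k[V]^G`, for `G = Spec H`. -/
def invariants (ρ : LinRep k H V) : Subalgebra k (CoordRing k V) :=
  AlgHom.equalizer ρ.coordCoact Algebra.TensorProduct.includeLeft

end General

section Diagonalizable

variable {k A V : Type*} [Field k] [AddCommGroup A] [AddCommGroup V] [Module k V]
  [FiniteDimensional k V]

/-- `x` is a basis of `V^*` of weight vectors, `x i` having weight `χ i`, for an action of the
diagonalizable group scheme `D(A) = Spec k[A]`: it satisfies `x i (g • v) = χ i (g) * x i v`.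
The dual basis of `V` then consists of weight vectors with the same weights. -/
def IsWeightBasis {ι : Type*} (ρ : LinRep k (AddMonoidAlgebra k A) V)
    (x : Module.Basis ι k (Module.Dual k V)) (χ : ι → A) : Prop :=
  ∀ i, ρ.dualCoact (x i) = x i ⊗ₜ[k] AddMonoidAlgebra.single (χ i) (1 : k)

/-- The induced action of the torus `D(A / torsion)` of `D(A)`. -/
def torusRep (ρ : LinRep k (AddMonoidAlgebra k A) V) :
    LinRep k (AddMonoidAlgebra k (A ⧸ AddCommGroup.torsion A)) V :=
  ρ.res (AddMonoidAlgebra.mapDomainBialgHom k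
    (QuotientAddGroup.mk' (AddCommGroup.torsion A)))

/-- The diagonal action of `D(A)` on `k^J`, for `J` finite, in which the `j`-th standard basis
vector (and the `j`-th coordinate function) has weight `w j`. -/
def diagonal (k : Type*) [Field k] {J : Type*} [Finite J] (w : J → A) :
    LinRep k (AddMonoidAlgebra k A) (J → k) where
  coact := (Pi.basisFun k J).constr k
    fun j => Pi.basisFun k J j ⊗ₜ[k] AddMonoidAlgebra.single (w j) (1 : k)
  counit_coact v := by
    refine LinearMap.congr_fun (f := (TensorProduct.rid k (J → k)).toLinearMap ∘ₗ
      (Coalgebra.counit (R := k) (A := AddMonoidAlgebra k A)).lTensor (J → k) ∘ₗ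
      (Pi.basisFun k J).constr k _) (g := LinearMap.id) ?_ v
    refine (Pi.basisFun k J).ext fun j => ?_
    simp [-Pi.basisFun_apply]
  coassoc v := by
    set c := (Pi.basisFun k J).constr k
      fun j => Pi.basisFun k J j ⊗ₜ[k] AddMonoidAlgebra.single (w j) (1 : k) with hc
    have hcj : ∀ j, c (Pi.basisFun k J j) =
        Pi.basisFun k J j ⊗ₜ[k] AddMonoidAlgebra.single (w j) (1 : k) :=
      fun j => Module.Basis.constr_basis _ _ _ _
    refine LinearMap.congr_fun (f := (TensorProduct.assoc k (J → k) (AddMonoidAlgebra k A)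
      (AddMonoidAlgebra k A)).toLinearMap ∘ₗ c.rTensor (AddMonoidAlgebra k A) ∘ₗ c)
      (g := (Coalgebra.comul (R := k) (A := AddMonoidAlgebra k A)).lTensor (J → k) ∘ₗ c) ?_ v
    refine (Pi.basisFun k J).ext fun j => ?_
    simp [-Pi.basisFun_apply, hcj]

end Diagonalizable

end LinRep

/-! ### MSOP -/

/-- `S` picks out an MSOP basis from the family of weights `χ` (weights listed with their
multiplicities): the `χ i ⊗ 1`, `i ∈ S`, are a basis of `M ⊗ ℚ`, and all the other weights lie in
the non-positive orthant of that basis. -/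
def IsMSOPBasis {ι M : Type*} [AddCommGroup M] (χ : ι → M) (S : Finset ι) : Prop :=
  LinearIndependent ℚ (fun i : S => (1 : ℚ) ⊗ₜ[ℤ] χ i) ∧
  Submodule.span ℚ (Set.range fun i : S => (1 : ℚ) ⊗ₜ[ℤ] χ i) = ⊤ ∧
  ∀ j ∉ S, ∃ c : ι → ℚ, (∀ i, c i ≤ 0) ∧
    (1 : ℚ) ⊗ₜ[ℤ] χ j = ∑ i ∈ S, c i • ((1 : ℚ) ⊗ₜ[ℤ] χ i)

/-- The action of the torus `D(M)` on `W` has MSOP. -/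
def HasMSOP {k M W : Type*} [Field k] [AddCommGroup M] [AddCommGroup W] [Module k W]
    [FiniteDimensional k W] (ρ : LinRep k (AddMonoidAlgebra k M) W) : Prop :=
  ∃ (n : ℕ) (x : Module.Basis (Fin n) k (Module.Dual k W)) (χ : Fin n → M) (S : Finset (Fin n)),
    ρ.IsWeightBasis x χ ∧ IsMSOPBasis χ S

/-! ### Monoids: faces, quotients, actions on monoid algebras -/

section Monoids

variable {F : Type*} [AddCommMonoid F]

/-- A face of a commutative monoid. -/
def IsFace (N : AddSubmonoid F) : Prop :=
  ∀ a b, a + b ∈ N → a ∈ N ∧ b ∈ N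

/-- The face generated by a subset. -/
def faceGenerated (s : Set F) : AddSubmonoid F :=
  sInf {N | IsFace N ∧ s ⊆ N}

/-- The congruence defining `F / N`: `a ∼ b` iff `a + u = b + v` for some `u, v ∈ N`. -/
def quotCon (N : AddSubmonoid F) : AddCon F where
  r a b := ∃ u ∈ N, ∃ v ∈ N, a + u = b + v
  iseqv := by
    refine ⟨fun a => ⟨0, N.zero_mem, 0, N.zero_mem, rfl⟩, ?_, ?_⟩
    · rintro a b ⟨u, hu, v, hv, h⟩
      exact ⟨v, hv, u, hu, h.symm⟩
    · rintro a b c ⟨u, hu, v, hv, h⟩ ⟨u', hu', v', hv', h'⟩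
      refine ⟨u + u', N.add_mem hu hu', v' + v, N.add_mem hv' hv, ?_⟩
      rw [← add_assoc, h, add_right_comm, h', add_assoc]
  add' := by
    rintro a b c d ⟨u, hu, v, hv, h⟩ ⟨u', hu', v', hv', h'⟩
    refine ⟨u + u', N.add_mem hu hu', v + v', N.add_mem hv hv', ?_⟩
    rw [add_add_add_comm, h, h', add_add_add_comm]

/-- The image of `N^gp` in `A` under `π^gp : F^gp → A`. -/
def gpImage {A : Type*} [AddCommGroup A] (π : F →+ A) (N : AddSubmonoid F) : AddSubgroup A :=
  AddSubgroup.closure (N.map π : Set A)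

/-- The homomorphism `F / N → A / B` induced by `π`, for `B` the image of `N^gp`. -/
def quotHom {A : Type*} [AddCommGroup A] (π : F →+ A) (N : AddSubmonoid F) :
    (quotCon N).Quotient →+ A ⧸ gpImage π N :=
  (quotCon N).lift ((QuotientAddGroup.mk' (gpImage π N)).comp π) (by
    rintro a b ⟨u, hu, v, hv, h⟩
    have key : ∀ w ∈ N, ((π w : A) : A ⧸ gpImage π N) = 0 := fun w hw =>
      (QuotientAddGroup.eq_zero_iff _).2 (AddSubgroup.subset_closure ⟨w, hw, rfl⟩)
    have := congrArg (fun z => ((π z : A) : A ⧸ gpImage π N)) h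
    simpa [key u hu, key v hv] using this)

/-- The action of `D(A)` on `Spec k[F]` induced by a homomorphism `p : F → A`, on coordinate
rings: `t^f ↦ t^f ⊗ t^(p f)`. -/
def monoidCoact (k : Type*) [Field k] {A : Type*} [AddCommGroup A] (p : F →+ A) :
    AddMonoidAlgebra k F →ₐ[k] AddMonoidAlgebra k F ⊗[k] AddMonoidAlgebra k A :=
  AddMonoidAlgebra.lift k _ F
    { toFun := fun f => AddMonoidAlgebra.single f.toAdd (1 : k) ⊗ₜ[k]
        AddMonoidAlgebra.single (p f.toAdd) (1 : k)
      map_one' := by simp [AddMonoidAlgebra.one_def, Algebra.TensorProduct.one_def]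
      map_mul' := fun f g => by simp [AddMonoidAlgebra.single_mul_single] }

/-- The ring of invariants `k[F]^{D(A)}`. -/
def monoidInvariants (k : Type*) [Field k] {A : Type*} [AddCommGroup A] (p : F →+ A) :
    Subalgebra k (AddMonoidAlgebra k F) :=
  AlgHom.equalizer (monoidCoact k p) Algebra.TensorProduct.includeLeft

end Monoids

/-! ### The data attached to a weight basis and an MSOP basis -/

/-- The isomorphism `k[V] ≅ k[F']`, `F' = ℕ^n`, given by a choice of linear coordinates. -/
def coordEquiv {k V : Type*} [Field k] [AddCommGroup V] [Module k V] {n : ℕ}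
    (x : Module.Basis (Fin n) k (Module.Dual k V)) :
    CoordRing k V ≃ₐ[k] AddMonoidAlgebra k (Fin n →₀ ℕ) :=
  SymmetricAlgebra.equivMvPolynomial x

/-- The standard generators of the free monoid `ℕ^n`. -/
def gen {n : ℕ} (i : Fin n) : Fin n →₀ ℕ := Finsupp.single i 1

/-- The homomorphism `π^gp : ℤ^n → A` induced by `π : ℕ^n → A`. -/
def gpHom {A : Type*} [AddCommGroup A] {n : ℕ} (π : (Fin n →₀ ℕ) →+ A) : (Fin n →₀ ℤ) →+ A :=
  Finsupp.liftAddHom fun i => zmultiplesHom A (π (gen i))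

/-- The inclusion `ℕ^n → ℤ^n` of the free monoid in its group completion. -/
def toGp (n : ℕ) : (Fin n →₀ ℕ) →+ (Fin n →₀ ℤ) :=
  Finsupp.mapRange.addMonoidHom (Nat.castAddMonoidHom ℤ)

/-- With `P = {p ∈ ℕ^n : π p = 0}` (so that `k[P]` is the ring of invariants), the group `P^gp` is
the whole kernel of `π^gp : ℤ^n → A`; for surjective `π^gp` this says `A = ℤ^n / P^gp`. -/
def IsPresentedByInvariants {A : Type*} [AddCommGroup A] {n : ℕ}
    (π : (Fin n →₀ ℕ) →+ A) : Prop :=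
  AddSubgroup.closure (toGp n '' {p | π p = 0}) = (gpHom π).ker

/-- The face `F'_0` of `F' = ℕ^n` generated by the generators indexed by `S`. -/
def msopFace {n : ℕ} (S : Finset (Fin n)) : AddSubmonoid (Fin n →₀ ℕ) :=
  faceGenerated (gen '' (S : Set (Fin n)))

/-- The homomorphism `k[V] ≅ k[F'] → k[F'/N]` induced by the projection `F' → F'/N`. -/
def toQuotAlg {k V : Type*} [Field k] [AddCommGroup V] [Module k V] {n : ℕ}
    (x : Module.Basis (Fin n) k (Module.Dual k V)) (N : AddSubmonoid (Fin n →₀ ℕ)) :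
    CoordRing k V →ₐ[k] AddMonoidAlgebra k (quotCon N).Quotient :=
  (AddMonoidAlgebra.mapDomainAlgHom k k (quotCon N).mk').comp (coordEquiv x : _ →ₐ[k] _)

/-- The linear action of `D(A/B)` on the affine space `Spec k[F'/F'_0]`, whose coordinates are the
classes of the generators not indexed by `S`: the generator `e_j` has weight its image in `A/B`. -/
def quotRep (k : Type*) [Field k] {A : Type*} [AddCommGroup A] {n : ℕ}
    (π : (Fin n →₀ ℕ) →+ A) (S : Finset (Fin n)) :
    LinRep k (AddMonoidAlgebra k (A ⧸ gpImage π (msopFace S))) ({j : Fin n // j ∉ S} → k) :=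
  LinRep.diagonal k fun j => quotHom π (msopFace S) ((quotCon (msopFace S)).mk' (gen j.1))

/-- `R` is a polynomial algebra over `k` in finitely many (possibly zero) variables. -/
def IsPolynomialAlgebra (k R : Type*) [Field k] [CommRing R] [Algebra k R] : Prop :=
  ∃ m : ℕ, Nonempty (R ≃ₐ[k] MvPolynomial (Fin m) k)

end

end DiagonalizableCST

namespace DiagonalizableCST

noncomputable section

/-! ### Monoids with polynomial monoid algebra -/

/-! In weight coordinates the invariant ring is the monoid algebra of `P = ker π`, so everything
reduces to the combinatorics of `P`. `P` is graded by total degree with only `0` in degree zero, and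
for such a monoid `k[P]` is polynomial iff `P` is free of finite rank
(`free_of_isPolynomialAlgebra`): the coefficients at atoms behave like cotangent coordinates at the
origin, so there are at most as many atoms as variables, and a surjective endomorphism of a
Noetherian ring is injective.

Part (1), contrapositively: if `P` is free, each generator has a coordinate occurring in no other
generator (`exists_coordinate`). Let `S` be the complement of a choice of such private coordinates.
Each generator, read as a relation, puts a positive multiple of its private weight in the negative
cone of the weights in `S`. A relation supported on `S` lies in `P^gp`, hence is an integral
combination of generators; evaluating at private coordinates kills its coefficients. So `S` is an
MSOP basis.

Part (2): given an exponent vector off `S` whose weight lies in `B`, that weight is an integral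
combination of the weights in `S`, unique by independence and with coefficients `≤ 0` by MSOP. Hence
there is exactly one way to complete the vector to an invariant monomial (`bijOn_quotCon_mk`). What
remains is a finite character group `C = A/B` acting diagonally. Closed subgroup schemes of a
diagonalizable group correspond to subgroups `E` of characters (`exists_eq_subgroupIdeal`), and `E`
gives a pseudo-reflection iff exactly one weight is outside it. So generation by pseudo-reflections
says that the subgroups generated by all weights but one meet in zero, which is equivalent to
freeness of the invariant monomials (`exists_equiv_mker_iff`). -/

theorem injective_of_surjective_endomorphism {R : Type*} [CommRing R] [IsNoetherianRing R]
    (f : R →+* R) (hf : Function.Surjective f) : Function.Injective f := by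
  have hmul : ∀ (n m : ℕ) (x : R), (f ^ (n + m)) x = (f ^ n) ((f ^ m) x) := fun n m x => by
    rw [pow_add]; rfl
  have hmono : Monotone fun n : ℕ => RingHom.ker (f ^ n) := by
    refine monotone_nat_of_le_succ fun n x hx => ?_
    rw [RingHom.mem_ker] at hx ⊢
    rw [add_comm, hmul, hx, map_zero]
  -- The kernels of the powers of `f` stabilize at some `n`. Writing `a ∈ ker f` as `f^n b` puts `b`
  -- in `ker f^(n+1) = ker f^n`, so `a = 0`.
  obtain ⟨n, hn⟩ := monotone_stabilizes_iff_noetherian.2 ‹IsNoetherianRing R› ⟨_, hmono⟩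
  have hs : Function.Surjective (f ^ n) := by
    rw [RingHom.coe_pow]; exact hf.iterate n
  rw [injective_iff_map_eq_zero]
  intro a ha
  obtain ⟨b, rfl⟩ := hs a
  have hb : b ∈ RingHom.ker (f ^ (n + 1)) := by
    rw [RingHom.mem_ker, add_comm, hmul, pow_one, ha]
  have := hn (n + 1) (Nat.le_succ n)
  simp only [OrderHom.coe_mk] at this
  rw [← this] at hb
  exact hb

/-- An atom of a commutative monoid: a nonzero element that is not a sum of nonzero elements. -/
def IsAtomic {P : Type*} [AddCommMonoid P] (p : P) : Prop :=
  p ≠ 0 ∧ ∀ a b, a + b = p → a = 0 ∨ b = 0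

section Free

variable {k P : Type*} [Field k] [AddCommMonoid P]

theorem closure_isAtomic (deg : P →+ ℕ) (hdeg : ∀ p, deg p = 0 → p = 0) :
    AddSubmonoid.closure {p : P | IsAtomic p} = ⊤ := by
  rw [eq_top_iff]
  rintro p -
  induction hd : deg p using Nat.strong_induction_on generalizing p with
  | _ d ih =>
  by_cases hp : IsAtomic p
  · exact AddSubmonoid.subset_closure hp
  · by_cases h0 : p = 0
    · rw [h0]; exact zero_mem _
    · simp only [IsAtomic, not_and, not_forall, not_or] at hp
      obtain ⟨a, b, rfl, ha, hb⟩ := hp h0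
      have ha' : deg a ≠ 0 := fun h => ha (hdeg a h)
      have hb' : deg b ≠ 0 := fun h => hb (hdeg b h)
      rw [map_add] at hd
      exact add_mem (ih (deg a) (by omega) rfl) (ih (deg b) (by omega) rfl)

/-- An atom decomposes only as `0 + a` and `a + 0`, so its coefficient functional obeys a Leibniz
rule relative to the coefficient at `0`. -/
theorem coeff_mul_of_isAtomic {a : P} (ha : IsAtomic a) (f g : AddMonoidAlgebra k P) :
    (f * g).coeff a = f.coeff 0 * g.coeff a + f.coeff a * g.coeff 0 := by
  classical
  induction f using AddMonoidAlgebra.induction_linear with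
  | zero => simp
  | add f₁ f₂ h₁ h₂ => simp only [add_mul, AddMonoidAlgebra.coeff_add, Finsupp.add_apply, h₁, h₂]; ring
  | single p r =>
  induction g using AddMonoidAlgebra.induction_linear with
  | zero => simp
  | add f₁ f₂ h₁ h₂ => simp only [mul_add, AddMonoidAlgebra.coeff_add, Finsupp.add_apply, h₁, h₂]; ring
  | single q s =>
  simp only [AddMonoidAlgebra.single_mul_single, AddMonoidAlgebra.coeff_single,
    Finsupp.single_apply]
  by_cases h : p + q = a
  · rcases ha.2 p q h with rfl | rfl
    · rw [zero_add] at h; subst h; simp [ha.1, ha.1.symm]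
    · rw [add_zero] at h; subst h; simp [ha.1, ha.1.symm]
  · have h1 : ¬ (p = 0 ∧ q = a) := by rintro ⟨rfl, rfl⟩; simp at h
    have h2 : ¬ (p = a ∧ q = 0) := by rintro ⟨rfl, rfl⟩; simp at h
    rw [if_neg h, ite_zero_mul_ite_zero, ite_zero_mul_ite_zero, if_neg h1, if_neg h2, add_zero]

/-- A linear relation valid on the variables extends, by the Leibniz rule, to a functional that
vanishes on every polynomial; testing it on the monomial of an atom kills the corresponding
coefficient. This bounds the number of atoms by `m`. -/
theorem linearIndependent_coeff_isAtomic {m : ℕ}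
    (e : AddMonoidAlgebra k P ≃ₐ[k] MvPolynomial (Fin m) k) :
    LinearIndependent k (fun (a : {p : P // IsAtomic p}) (i : Fin m) =>
      (e.symm (MvPolynomial.X i)).coeff a.1) := by
  classical
  rw [linearIndependent_iff]
  intro c hc
  have key : ∀ f : MvPolynomial (Fin m) k, c.sum (fun a r => r * (e.symm f).coeff a.1) = 0 := by
    intro f
    induction f using MvPolynomial.induction_on with
    | C r =>
      refine Finset.sum_eq_zero fun a _ => ?_
      have : e.symm (MvPolynomial.C r) = AddMonoidAlgebra.single 0 r := by
        rw [← MvPolynomial.algebraMap_eq, AlgEquiv.commutes]; rfl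
      rw [this]; simp [a.2.1.symm]
    | add f g hf hg =>
      simp only [map_add, AddMonoidAlgebra.coeff_add, Finsupp.add_apply, mul_add]
      rw [Finsupp.sum_add, hf, hg, add_zero]
    | mul_X f i hf =>
      have hi : c.sum (fun a r => r * (e.symm (MvPolynomial.X i)).coeff a.1) = 0 := by
        have := congrFun hc i
        simpa [Finsupp.linearCombination_apply, Finsupp.sum, Finset.sum_apply] using this
      have : c.sum (fun a r => r * (e.symm (f * MvPolynomial.X i)).coeff a.1) =
          (e.symm f).coeff 0 * c.sum (fun a r => r * (e.symm (MvPolynomial.X i)).coeff a.1) +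
          c.sum (fun a r => r * (e.symm f).coeff a.1) * (e.symm (MvPolynomial.X i)).coeff 0 := by
        simp only [Finsupp.sum, Finset.mul_sum, Finset.sum_mul, ← Finset.sum_add_distrib]
        refine Finset.sum_congr rfl fun a _ => ?_
        rw [map_mul, coeff_mul_of_isAtomic a.2]; ring
      rw [this, hi, hf]; ring
  ext a
  have := key (e (AddMonoidAlgebra.single a.1 1))
  rw [AlgEquiv.symm_apply_apply] at this
  rw [Finsupp.sum, Finset.sum_eq_single a] at this
  · simpa using this
  · intro b _ hb
    have : a.1 ≠ b.1 := fun h => hb (Subtype.ext h.symm)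
    simp [this]
  · intro h; rw [Finsupp.notMem_support_iff.1 h, zero_mul]

theorem free_of_isPolynomialAlgebra (deg : P →+ ℕ) (hdeg : ∀ p, deg p = 0 → p = 0)
    (h : IsPolynomialAlgebra k (AddMonoidAlgebra k P)) :
    ∃ m : ℕ, Nonempty ((Fin m →₀ ℕ) ≃+ P) := by
  classical
  obtain ⟨m, ⟨e⟩⟩ := h
  have hli := linearIndependent_coeff_isAtomic e
  have : Finite {p : P // IsAtomic p} := hli.finite
  have := Fintype.ofFinite {p : P // IsAtomic p}
  have hcard := hli.fintype_card_le_finrank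
  rw [Module.finrank_fin_fun] at hcard
  obtain ⟨s⟩ : Nonempty ({p : P // IsAtomic p} ↪ Fin m) :=
    Function.Embedding.nonempty_of_card_le (by simpa using hcard)
  -- Indices that name no atom are sent to `0`; the injectivity proved below shows afterwards that
  -- there are none.
  let σ : Fin m → P := Function.extend s Subtype.val 0
  let Φ : (Fin m →₀ ℕ) →+ P := Finsupp.liftAddHom fun i => multiplesHom P (σ i)
  have hΦ : ∀ i, Φ (Finsupp.single i 1) = σ i := fun i => by simp [Φ]
  have hsurj : Function.Surjective Φ := by
    rw [← AddMonoidHom.mrange_eq_top, eq_top_iff, ← closure_isAtomic deg hdeg,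
      AddSubmonoid.closure_le]
    intro p hp
    exact ⟨Finsupp.single (s ⟨p, hp⟩) 1, by rw [hΦ]; exact s.injective.extend_apply _ _ _⟩
  let Ψ : MvPolynomial (Fin m) k →ₐ[k] AddMonoidAlgebra k P :=
    AddMonoidAlgebra.mapDomainAlgHom k k Φ
  have hΨ : ∀ q, Ψ (MvPolynomial.monomial q 1) = AddMonoidAlgebra.single (Φ q) 1 := fun q =>
    AddMonoidAlgebra.mapDomain_single
  have hΨs : Function.Surjective Ψ := by
    intro f
    induction f using AddMonoidAlgebra.induction_linear with
    | zero => exact ⟨0, map_zero _⟩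
    | add f g hf hg =>
      obtain ⟨f, rfl⟩ := hf
      obtain ⟨g, rfl⟩ := hg
      exact ⟨f + g, map_add _ _ _⟩
    | single p r =>
      obtain ⟨q, rfl⟩ := hsurj p
      exact ⟨MvPolynomial.monomial q r, AddMonoidAlgebra.mapDomain_single⟩
  have hinj := injective_of_surjective_endomorphism
    ((e : AddMonoidAlgebra k P →ₐ[k] MvPolynomial (Fin m) k).comp Ψ).toRingHom
    (e.surjective.comp hΨs)
  refine ⟨m, ⟨AddEquiv.ofBijective Φ ⟨fun p q hpq => ?_, hsurj⟩⟩⟩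
  have h1 : Ψ (MvPolynomial.monomial p 1) = Ψ (MvPolynomial.monomial q 1) := by
    rw [hΨ, hΨ, hpq]
  have h2 := hinj (congrArg e h1)
  exact MvPolynomial.monomial_left_injective one_ne_zero h2

end Free

/-! ### Invariants of diagonalizable actions on monoid algebras -/

/-- The coefficient of a tensor `∑ f ⊗ g` at `q`, i.e. `∑ f_q g`. -/
def coeffTensor (k : Type*) [Field k] {F : Type*} (q : F) (H : Type*) [AddCommGroup H] [Module k H] :
    AddMonoidAlgebra k F ⊗[k] H →ₗ[k] H :=
  (TensorProduct.lid k H).toLinearMap ∘ₗ LinearMap.rTensor H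
    (Finsupp.lapply q ∘ₗ (AddMonoidAlgebra.coeffLinearEquiv k).toLinearMap)

theorem coeffTensor_tmul {k F : Type*} [Field k] {H : Type*} [AddCommGroup H] [Module k H] (q : F)
    (f : AddMonoidAlgebra k F) (h : H) : coeffTensor k q H (f ⊗ₜ h) = f.coeff q • h := by
  simp [coeffTensor]

section MonoidInvariants

variable {k F A : Type*} [Field k] [AddCommMonoid F] [AddCommGroup A]

theorem monoidCoact_single (p : F →+ A) (q : F) (r : k) :
    monoidCoact k p (AddMonoidAlgebra.single q r) =
      AddMonoidAlgebra.single q r ⊗ₜ AddMonoidAlgebra.single (p q) 1 := by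
  have h : (AddMonoidAlgebra.single q r : AddMonoidAlgebra k F) =
      r • AddMonoidAlgebra.single q 1 := by simp
  rw [h, map_smul, ← TensorProduct.smul_tmul']
  simp [monoidCoact]

theorem coeffTensor_monoidCoact (p : F →+ A) (q : F) (f : AddMonoidAlgebra k F) :
    coeffTensor k q _ (monoidCoact k p f) = f.coeff q • AddMonoidAlgebra.single (p q) (1 : k) := by
  classical
  induction f using AddMonoidAlgebra.induction_linear with
  | zero => simp
  | add f g hf hg => rw [map_add, map_add, hf, hg, AddMonoidAlgebra.coeff_add, Finsupp.add_apply,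
      add_smul]
  | single s r =>
    rw [monoidCoact_single, coeffTensor_tmul]
    by_cases h : s = q
    · rw [h]
    · simp [h]

theorem mem_monoidInvariants_iff (p : F →+ A) (f : AddMonoidAlgebra k F) :
    f ∈ monoidInvariants k p ↔ ∀ q, f.coeff q ≠ 0 → p q = 0 := by
  have hf : f ∈ monoidInvariants k p ↔ monoidCoact k p f = f ⊗ₜ[k] 1 := Iff.rfl
  rw [hf]
  constructor
  · intro h q hq
    have := coeffTensor_monoidCoact p q f
    -- At `q`, invariance reads `f_q • 1 = f_q • t^(p q)`, so a nonzero coefficient forces weight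
    -- zero.
    rw [h, coeffTensor_tmul] at this
    have := smul_right_injective _ hq this
    exact (AddMonoidAlgebra.single_left_injective one_ne_zero this).symm
  · intro h
    conv_lhs => rw [← AddMonoidAlgebra.sum_coeff_single f]
    conv_rhs => rw [← AddMonoidAlgebra.sum_coeff_single f]
    rw [Finsupp.sum, map_sum, TensorProduct.sum_tmul]
    refine Finset.sum_congr rfl fun q hq => ?_
    rw [monoidCoact_single, h q (Finsupp.mem_support_iff.1 hq)]
    rfl

/-- The ring of invariants of `k[F]` is the monoid algebra of the kernel of the weight map. -/
def monoidInvariantsEquiv (p : F →+ A) :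
    AddMonoidAlgebra k (AddMonoidHom.mker p) ≃ₐ[k] monoidInvariants k p :=
  AlgEquiv.ofBijective
    ((AddMonoidAlgebra.mapDomainAlgHom k k (AddMonoidHom.mker p).subtype).codRestrict _ (by
      intro f
      induction f using AddMonoidAlgebra.induction_linear with
      | zero => rw [map_zero]; exact zero_mem _
      | add f g hf hg => rw [map_add]; exact add_mem hf hg
      | single q r =>
        rw [mem_monoidInvariants_iff]
        intro s hs
        have : (AddMonoidAlgebra.mapDomainAlgHom k k (AddMonoidHom.mker p).subtype)
          (AddMonoidAlgebra.single q r) = AddMonoidAlgebra.single q.1 r :=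
          AddMonoidAlgebra.mapDomain_single
        rw [this, AddMonoidAlgebra.coeff_single] at hs
        have : q.1 = s := by by_contra h; simp [h] at hs
        rw [← this]; exact q.2)) (by
    refine ⟨fun f g hfg => ?_, fun f => ?_⟩
    · exact AddMonoidAlgebra.mapDomain_injective Subtype.val_injective (congrArg Subtype.val hfg)
    · refine ⟨AddMonoidAlgebra.comapDomain Subtype.val Subtype.val_injective f.1, Subtype.ext ?_⟩
      refine AddMonoidAlgebra.mapDomain_comapDomain (f := Subtype.val) (fun q hq => ?_) _
      exact ⟨⟨q, (mem_monoidInvariants_iff p f.1).1 f.2 q (Finsupp.mem_support_iff.1 hq)⟩, rfl⟩)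

theorem bijOn_monoidInvariants {F' A' : Type*} [AddCommMonoid F'] [AddCommGroup A'] (p : F →+ A)
    (p' : F' →+ A') (φ : F →+ F') (hφ : Set.BijOn φ {q | p q = 0} {q | p' q = 0}) :
    Set.BijOn (AddMonoidAlgebra.mapDomainAlgHom k k φ) (monoidInvariants k p)
      (monoidInvariants k p') := by
  let ψ : AddMonoidHom.mker p →+ AddMonoidHom.mker p' :=
    (φ.comp (AddMonoidHom.mker p).subtype).codRestrict _ fun q => hφ.mapsTo q.2
  let e : AddMonoidHom.mker p ≃+ AddMonoidHom.mker p' := AddEquiv.ofBijective ψ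
    ⟨fun a b h => Subtype.ext (hφ.injOn a.2 b.2 (congrArg Subtype.val h)), fun b => by
      obtain ⟨a, ha, h⟩ := hφ.surjOn b.2
      exact ⟨⟨a, ha⟩, Subtype.ext h⟩⟩
  let E : monoidInvariants k p ≃ₐ[k] monoidInvariants k p' :=
    (monoidInvariantsEquiv p).symm.trans
      ((AddMonoidAlgebra.domCongr k k e).trans (monoidInvariantsEquiv p'))
  have hE : ∀ f, (E f : AddMonoidAlgebra k F') = AddMonoidAlgebra.mapDomainAlgHom k k φ f := by
    intro f
    obtain ⟨g, rfl⟩ := (monoidInvariantsEquiv p).surjective f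
    simp only [E, AlgEquiv.trans_apply, AlgEquiv.symm_apply_apply]
    induction g using AddMonoidAlgebra.induction_linear with
    | zero => simp
    | add g h hg hh => simp only [map_add, Subalgebra.coe_add, hg, hh]
    | single q r =>
      rw [AddMonoidAlgebra.domCongr_single]
      change AddMonoidAlgebra.mapDomain _ _ =
        AddMonoidAlgebra.mapDomain _ (AddMonoidAlgebra.mapDomain _ _)
      simp only [AddMonoidAlgebra.mapDomain_single]
      rfl
  refine ⟨fun f hf => ?_, fun f hf g hg h => ?_, fun g hg => ?_⟩
  · rw [← hE ⟨f, hf⟩]; exact (E ⟨f, hf⟩).2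
  · rw [← hE ⟨f, hf⟩, ← hE ⟨g, hg⟩] at h
    exact congrArg Subtype.val (E.injective (Subtype.ext h))
  · obtain ⟨f, hf⟩ := E.surjective ⟨g, hg⟩
    exact ⟨f.1, f.2, by rw [← hE, hf]⟩

theorem IsPolynomialAlgebra.congr {R R' : Type*} [CommRing R] [CommRing R'] [Algebra k R]
    [Algebra k R'] (e : R ≃ₐ[k] R') : IsPolynomialAlgebra k R ↔ IsPolynomialAlgebra k R' :=
  ⟨fun ⟨m, ⟨f⟩⟩ => ⟨m, ⟨e.symm.trans f⟩⟩, fun ⟨m, ⟨f⟩⟩ => ⟨m, ⟨e.trans f⟩⟩⟩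

/-- The algebra of invariants of `k[F]` is polynomial iff the monoid of invariant monomials is
free. -/
theorem isPolynomialAlgebra_monoidInvariants_iff (p : F →+ A) (deg : F →+ ℕ)
    (hdeg : ∀ q, deg q = 0 → q = 0) :
    IsPolynomialAlgebra k (monoidInvariants k p) ↔
      ∃ m : ℕ, Nonempty ((Fin m →₀ ℕ) ≃+ AddMonoidHom.mker p) := by
  rw [← IsPolynomialAlgebra.congr (monoidInvariantsEquiv p)]
  constructor
  · exact free_of_isPolynomialAlgebra (deg.comp (AddMonoidHom.mker p).subtype)
      fun q hq => Subtype.ext (hdeg q.1 hq)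
  · rintro ⟨m, ⟨e⟩⟩
    exact ⟨m, ⟨(AddMonoidAlgebra.domCongr k k e).symm⟩⟩

end MonoidInvariants

/-! ### Transport of coactions and invariants to monomial coordinates. -/

section Equivariance

variable {k A V : Type*} [Field k] [AddCommGroup A] [AddCommGroup V] [Module k V]
  [FiniteDimensional k V]

/-- An identification of `k[V]` with a monoid algebra that maps weight coordinates to monomials of
the same weight is equivariant. -/
theorem monoidCoact_apply_equiv {ι F : Type*} [AddCommMonoid F]
    {ρ : LinRep k (AddMonoidAlgebra k A) V}
    {x : Module.Basis ι k (Module.Dual k V)} {χ : ι → A} (hx : ρ.IsWeightBasis x χ)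
    (p : F →+ A) (g : ι → F) (hp : ∀ i, p (g i) = χ i)
    (E : CoordRing k V ≃ₐ[k] AddMonoidAlgebra k F)
    (hE : ∀ i, E (SymmetricAlgebra.ι k _ (x i)) = AddMonoidAlgebra.single (g i) 1)
    (f : CoordRing k V) :
    monoidCoact k p (E f) =
      Algebra.TensorProduct.map (E : _ →ₐ[k] _) (AlgHom.id k _) (ρ.coordCoact f) := by
  have : (monoidCoact k p).comp (E : CoordRing k V →ₐ[k] _) =
      (Algebra.TensorProduct.map (E : CoordRing k V →ₐ[k] _) (AlgHom.id k _)).comp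
        ρ.coordCoact := by
    refine SymmetricAlgebra.algHom_ext (x.ext fun i => ?_)
    change monoidCoact k p (E (SymmetricAlgebra.ι k _ (x i))) =
      Algebra.TensorProduct.map (E : CoordRing k V →ₐ[k] _) (AlgHom.id k _)
        (ρ.coordCoact (SymmetricAlgebra.ι k _ (x i)))
    rw [hE, monoidCoact_single, LinRep.coordCoact, SymmetricAlgebra.lift_ι_apply,
      LinearMap.comp_apply, hx i]
    simp [hE, hp]
  exact DFunLike.congr_fun this f

theorem mem_invariants_iff {F : Type*} [AddCommMonoid F]
    {ρ : LinRep k (AddMonoidAlgebra k A) V} (p : F →+ A)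
    (E : CoordRing k V ≃ₐ[k] AddMonoidAlgebra k F)
    (hE : ∀ f, monoidCoact k p (E f) =
      Algebra.TensorProduct.map (E : _ →ₐ[k] _) (AlgHom.id k _) (ρ.coordCoact f))
    (f : CoordRing k V) : f ∈ ρ.invariants ↔ E f ∈ monoidInvariants k p := by
  have h1 : f ∈ ρ.invariants ↔ ρ.coordCoact f = f ⊗ₜ[k] 1 := Iff.rfl
  have h2 : E f ∈ monoidInvariants k p ↔ monoidCoact k p (E f) = E f ⊗ₜ[k] 1 := Iff.rfl
  let T : CoordRing k V ⊗[k] AddMonoidAlgebra k A ≃ₐ[k]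
      AddMonoidAlgebra k F ⊗[k] AddMonoidAlgebra k A :=
    Algebra.TensorProduct.congr E AlgEquiv.refl
  have hT : ∀ z, Algebra.TensorProduct.map (E : _ →ₐ[k] _) (AlgHom.id k _) z = T z := fun z => rfl
  have h3 : E f ⊗ₜ[k] (1 : AddMonoidAlgebra k A) = T (f ⊗ₜ 1) := rfl
  rw [h1, h2, hE, hT, h3, T.injective.eq_iff]

theorem image_invariants {F : Type*} [AddCommMonoid F]
    {ρ : LinRep k (AddMonoidAlgebra k A) V} (p : F →+ A)
    (E : CoordRing k V ≃ₐ[k] AddMonoidAlgebra k F)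
    (hE : ∀ f, monoidCoact k p (E f) =
      Algebra.TensorProduct.map (E : _ →ₐ[k] _) (AlgHom.id k _) (ρ.coordCoact f)) :
    ρ.invariants.map (E : CoordRing k V →ₐ[k] _) = monoidInvariants k p := by
  ext g
  rw [Subalgebra.mem_map]
  constructor
  · rintro ⟨f, hf, rfl⟩; exact (mem_invariants_iff p E hE f).1 hf
  · intro hg
    refine ⟨E.symm g, (mem_invariants_iff p E hE _).2 ?_, E.apply_symm_apply g⟩
    rwa [E.apply_symm_apply]

theorem isPolynomialAlgebra_invariants_iff {F : Type*} [AddCommMonoid F]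
    {ρ : LinRep k (AddMonoidAlgebra k A) V} (p : F →+ A)
    (E : CoordRing k V ≃ₐ[k] AddMonoidAlgebra k F)
    (hE : ∀ f, monoidCoact k p (E f) =
      Algebra.TensorProduct.map (E : _ →ₐ[k] _) (AlgHom.id k _) (ρ.coordCoact f)) :
    IsPolynomialAlgebra k ρ.invariants ↔ IsPolynomialAlgebra k (monoidInvariants k p) := by
  rw [← image_invariants p E hE]
  exact IsPolynomialAlgebra.congr (E.subalgebraMap ρ.invariants)

end Equivariance

/-! ### Closed subgroup schemes of diagonalizable group schemes -/

section HopfIdeals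

variable (k : Type*) [Field k] {A : Type*} [AddCommGroup A]

/-- The ideal of the closed subgroup scheme `D(A / E)` of `D(A)`. -/
def subgroupIdeal (E : AddSubgroup A) : Ideal (AddMonoidAlgebra k A) :=
  RingHom.ker (AddMonoidAlgebra.mapDomainBialgHom k (QuotientAddGroup.mk' E))

variable {k}

theorem mem_subgroupIdeal_iff (E : AddSubgroup A) (f : AddMonoidAlgebra k A) :
    f ∈ subgroupIdeal k E ↔
      AddMonoidAlgebra.mapDomainBialgHom k (QuotientAddGroup.mk' E) f = 0 :=
  Iff.rfl

theorem single_sub_one_mem_subgroupIdeal_iff (E : AddSubgroup A) (a : A) :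
    AddMonoidAlgebra.single a (1 : k) - 1 ∈ subgroupIdeal k E ↔ a ∈ E := by
  rw [mem_subgroupIdeal_iff, map_sub, map_one, sub_eq_zero,
    AddMonoidAlgebra.mapDomainBialgHom_single, AddMonoidAlgebra.one_def,
    AddMonoidAlgebra.single_left_inj one_ne_zero]
  exact QuotientAddGroup.eq_zero_iff a

/-- The kernel of a morphism of Hopf algebras is a Hopf ideal. For the comultiplication, flatness
over a field makes the tensor square of the injection `k[A]/ker → k[A/E]` injective. -/
theorem isHopfIdeal_subgroupIdeal (E : AddSubgroup A) : (subgroupIdeal k E).IsHopfIdeal k := by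
  set f := AddMonoidAlgebra.mapDomainBialgHom k (QuotientAddGroup.mk' E) with hf
  let fl : AddMonoidAlgebra k A →ₗ[k] AddMonoidAlgebra k (A ⧸ E) := (f : _ →ₗ[k] _)
  have hI : ((subgroupIdeal k E).restrictScalars k) = LinearMap.ker fl := by
    ext x; rfl
  refine { counit_eq_zero := fun x hx => ?_, map_mkQ_comul_eq_zero := fun x hx => ?_,
           antipode_mem := fun x hx => ?_ }
  · have hx' : f x = 0 := hx
    have := congrArg (Coalgebra.counit (R := k)) hx'
    rwa [map_zero, CoalgHomClass.counit_comp_apply] at this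
  · rw [hI] at hx ⊢
    have hx' : f x = 0 := hx
    let i := (LinearMap.ker fl).liftQ fl le_rfl
    have hi : Function.Injective i := by
      rw [← LinearMap.ker_eq_bot]; exact Submodule.ker_liftQ_eq_bot _ _ _ le_rfl
    have hii : Function.Injective (TensorProduct.map i i) :=
      TensorProduct.map_injective_of_flat_flat _ _ hi hi
    apply hii
    rw [map_zero, ← LinearMap.comp_apply, ← TensorProduct.map_comp, Submodule.liftQ_mkQ]
    have := CoalgHomClass.map_comp_comul_apply f x
    rw [hx', map_zero] at this
    exact this
  · have key : ∀ y : AddMonoidAlgebra k A,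
        f (HopfAlgebra.antipode k y) = HopfAlgebra.antipode k (f y) := by
      intro y
      induction y using AddMonoidAlgebra.induction_linear with
      | zero => simp
      | add y z hy hz => simp only [map_add, hy, hz]
      | single a r => simp [hf]
    have hx' : f x = 0 := hx
    change f _ = 0
    rw [key, hx', map_zero]

theorem subgroupIdeal_le_iff (E D : AddSubgroup A) :
    subgroupIdeal k E ≤ subgroupIdeal k D ↔ E ≤ D := by
  constructor
  · intro h a ha
    rw [← single_sub_one_mem_subgroupIdeal_iff (k := k)] at ha ⊢
    exact h ha
  · intro h f hf
    rw [mem_subgroupIdeal_iff] at hf ⊢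
    have hc : QuotientAddGroup.mk' D = (QuotientAddGroup.map E D (AddMonoidHom.id A) h).comp
        (QuotientAddGroup.mk' E) := rfl
    rw [hc, AddMonoidAlgebra.mapDomainBialgHom_comp, BialgHom.comp_apply, hf, map_zero]

theorem subgroupIdeal_bot : subgroupIdeal k (⊥ : AddSubgroup A) = ⊥ := by
  rw [eq_bot_iff]
  intro f hf
  rw [mem_subgroupIdeal_iff] at hf
  have hinj : Function.Injective (QuotientAddGroup.mk' (⊥ : AddSubgroup A)) := by
    rw [← AddMonoidHom.ker_eq_bot_iff, QuotientAddGroup.ker_mk']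
  refine AddMonoidAlgebra.mapDomain_injective hinj ?_
  rw [AddMonoidAlgebra.mapDomain_zero]
  exact hf

/-- Take for `E` the characters that become `1` modulo `I`. The images of characters are group-like,
and distinct group-like elements are linearly independent, so the quotient identifies characters
only modulo `E` and imposes no further relation. -/
theorem exists_eq_subgroupIdeal (I : Ideal (AddMonoidAlgebra k A)) (hI : I.IsHopfIdeal k) :
    ∃ E : AddSubgroup A, I = subgroupIdeal k E := by
  let q := Ideal.Quotient.mk I
  have hq : ∀ a : A, q (AddMonoidAlgebra.single a 1) = 1 ↔
      AddMonoidAlgebra.single a (1 : k) - 1 ∈ I := fun a => by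
    rw [← map_one q]; exact Ideal.Quotient.mk_eq_mk_iff_sub_mem _ _
  have hmul : ∀ a b : A, q (AddMonoidAlgebra.single (a + b) 1) =
      q (AddMonoidAlgebra.single a 1) * q (AddMonoidAlgebra.single b 1) := fun a b => by
    rw [← map_mul, AddMonoidAlgebra.single_mul_single, one_mul]
  have h0 : q (AddMonoidAlgebra.single 0 1) = 1 := map_one q
  let E : AddSubgroup A :=
    { carrier := {a | q (AddMonoidAlgebra.single a 1) = 1}
      zero_mem' := h0
      add_mem' := fun {a b} ha hb => by
        rw [Set.mem_ofPred_eq] at *; rw [hmul, ha, hb, one_mul]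
      neg_mem' := fun {a} ha => by
        rw [Set.mem_ofPred_eq] at *
        have := hmul (-a) a
        rwa [neg_add_cancel, h0, ha, mul_one, eq_comm] at this }
  have hE : ∀ a b : A, (a : A ⧸ E) = b ↔
      q (AddMonoidAlgebra.single a 1) = q (AddMonoidAlgebra.single b 1) := fun a b => by
    rw [QuotientAddGroup.eq]
    change q (AddMonoidAlgebra.single (-a + b) 1) = 1 ↔ _
    have hu : q (AddMonoidAlgebra.single (-a) 1) * q (AddMonoidAlgebra.single a 1) = 1 := by
      rw [← hmul, neg_add_cancel, h0]
    rw [hmul]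
    constructor
    · intro h
      calc q (AddMonoidAlgebra.single a 1)
          = q (AddMonoidAlgebra.single a 1) * (q (AddMonoidAlgebra.single (-a) 1) *
            q (AddMonoidAlgebra.single b 1)) := by rw [h, mul_one]
        _ = (q (AddMonoidAlgebra.single (-a) 1) * q (AddMonoidAlgebra.single a 1)) *
            q (AddMonoidAlgebra.single b 1) := by ring
        _ = _ := by rw [hu, one_mul]
    · intro h; rw [← h, hu]
  let g : A ⧸ E → AddMonoidAlgebra k A ⧸ I := fun c => q (AddMonoidAlgebra.single c.out 1)
  have hg : ∀ a : A, g a = q (AddMonoidAlgebra.single a 1) := fun a =>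
    (hE _ _).1 (QuotientAddGroup.out_eq' _)
  have hginj : Function.Injective g := by
    intro c d h
    obtain ⟨a, rfl⟩ := QuotientAddGroup.mk_surjective c
    obtain ⟨b, rfl⟩ := QuotientAddGroup.mk_surjective d
    rw [hg, hg] at h
    exact (hE a b).2 h
  have hgl : ∀ c, IsGroupLikeElem k (g c) := fun c =>
    (AddMonoidAlgebra.isGroupLikeElem_single_one (R := k) (A := k) c.out).map
      (Bialgebra.Quotient.mkBialgHom (R := k) I)
  have hli : LinearIndependent k g := by
    have h := linearIndepOn_isGroupLikeElem (R := k) (A := AddMonoidAlgebra k A ⧸ I)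
    exact LinearIndependent.comp h (fun c => ⟨g c, hgl c⟩)
      fun c d hcd => hginj (congrArg Subtype.val hcd)
  have hcomp : ∀ f : AddMonoidAlgebra k A, q f = Finsupp.linearCombination k g
      (AddMonoidAlgebra.mapDomainBialgHom k (QuotientAddGroup.mk' E) f).coeff := by
    intro f
    induction f using AddMonoidAlgebra.induction_linear with
    | zero => simp
    | add f h hf hh => simp only [map_add, hf, hh, AddMonoidAlgebra.coeff_add]
    | single a r =>
      rw [AddMonoidAlgebra.mapDomainBialgHom_single, AddMonoidAlgebra.coeff_single,
        Finsupp.linearCombination_single, QuotientAddGroup.mk'_apply, hg]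
      have : AddMonoidAlgebra.single a r = r • AddMonoidAlgebra.single a (1 : k) := by simp
      rw [this]
      exact map_smul (Ideal.Quotient.mkₐ k I) r _
  refine ⟨E, ?_⟩
  ext f
  rw [mem_subgroupIdeal_iff, ← Ideal.Quotient.eq_zero_iff_mem]
  change q f = 0 ↔ _
  rw [hcomp, ← AddMonoidAlgebra.coeff_eq_zero]
  exact ⟨fun h => hli (h.trans (map_zero _).symm), fun h => by rw [h, map_zero]⟩

end HopfIdeals

/-! ### Weight bases -/

section Contraction

variable {k V : Type*} [Field k] [AddCommGroup V] [Module k V]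

/-- Contraction of a tensor with a linear form on its first factor. -/
def contract (φ : Module.Dual k V) (M : Type*) [AddCommGroup M] [Module k M] : V ⊗[k] M →ₗ[k] M :=
  (TensorProduct.lid k M).toLinearMap ∘ₗ φ.rTensor M

theorem contract_tmul {M : Type*} [AddCommGroup M] [Module k M] (φ : Module.Dual k V) (v : V)
    (m : M) : contract φ M (v ⊗ₜ m) = φ v • m := by simp [contract]

theorem contract_lTensor {M N : Type*} [AddCommGroup M] [Module k M] [AddCommGroup N] [Module k N]
    (φ : Module.Dual k V) (g : M →ₗ[k] N) (z : V ⊗[k] M) :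
    contract φ N (g.lTensor V z) = g (contract φ M z) := by
  induction z with
  | zero => simp
  | add y z hy hz => simp only [map_add, hy, hz]
  | tmul v m => rw [LinearMap.lTensor_tmul, contract_tmul, contract_tmul, map_smul]

theorem contract_add {M : Type*} [AddCommGroup M] [Module k M] (φ ψ : Module.Dual k V)
    (z : V ⊗[k] M) : contract (φ + ψ) M z = contract φ M z + contract ψ M z := by
  simp [contract, LinearMap.rTensor_add]

theorem contract_smul {M : Type*} [AddCommGroup M] [Module k M] (c : k) (φ : Module.Dual k V)
    (z : V ⊗[k] M) : contract (c • φ) M z = c • contract φ M z := by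
  simp [contract, LinearMap.rTensor_smul]

-- Vanishing on a basis of forms gives vanishing on all forms, in particular on the coordinate forms
-- of a basis of `V`, from which the tensor is reconstructed.
theorem eq_zero_of_contract_eq_zero [FiniteDimensional k V] {ι M : Type*} [AddCommGroup M]
    [Module k M] (x : Module.Basis ι k (Module.Dual k V)) (z : V ⊗[k] M)
    (h : ∀ i, contract (x i) M z = 0) : z = 0 := by
  have hall : ∀ φ : Module.Dual k V, contract φ M z = 0 := by
    intro φ
    have hφ : φ ∈ Submodule.span k (Set.range x) := by rw [x.span_eq]; trivial
    induction hφ using Submodule.span_induction with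
    | mem φ hφ => obtain ⟨i, rfl⟩ := hφ; exact h i
    | zero => simp [contract]
    | add φ ψ _ _ h₁ h₂ => rw [contract_add, h₁, h₂, add_zero]
    | smul c φ _ h₁ => rw [contract_smul, h₁, smul_zero]
  let b := Module.finBasis k V
  have hz : ∀ z : V ⊗[k] M, z = ∑ i, b i ⊗ₜ[k] contract (b.coord i) M z := by
    intro z
    induction z with
    | zero => simp
    | add y z hy hz =>
      simp only [map_add, TensorProduct.tmul_add, Finset.sum_add_distrib]
      rw [← hy, ← hz]
    | tmul v m =>
      simp only [contract_tmul, TensorProduct.tmul_smul, TensorProduct.smul_tmul',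
        ← TensorProduct.sum_tmul, Module.Basis.coord_apply, b.sum_repr]
  rw [hz z]
  simp [hall]

end Contraction

section WeightBasis

variable {k A V : Type*} [Field k] [AddCommGroup A] [AddCommGroup V] [Module k V]
  [FiniteDimensional k V]

theorem dualCoact_eq_tmul_iff {H : Type*} [CommRing H] [HopfAlgebra k H] (ρ : LinRep k H V)
    (φ : Module.Dual k V) (h : H) :
    ρ.dualCoact φ = φ ⊗ₜ h ↔ ∀ v, contract φ H (ρ.coact v) = φ v • h := by
  have h1 : ρ.dualCoact φ = φ ⊗ₜ h ↔
      contract φ H ∘ₗ ρ.coact = dualTensorHomEquiv k V H (φ ⊗ₜ h) := by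
    rw [← LinearEquiv.symm_apply_eq]; rfl
  rw [h1, LinearMap.ext_iff]
  simp [dualTensorHomEquiv]

theorem isWeightBasis_iff {ι : Type*} {ρ : LinRep k (AddMonoidAlgebra k A) V}
    {x : Module.Basis ι k (Module.Dual k V)} {χ : ι → A} :
    ρ.IsWeightBasis x χ ↔ ∀ i v, contract (x i) _ (ρ.coact v) =
      x i v • AddMonoidAlgebra.single (χ i) (1 : k) :=
  forall_congr' fun _ => dualCoact_eq_tmul_iff _ _ _

theorem isWeightBasis_of_coact_basis {ι : Type*} [Finite ι] [DecidableEq ι]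
    {ρ : LinRep k (AddMonoidAlgebra k A) V} (b : Module.Basis ι k V) (χ : ι → A)
    (h : ∀ i, ρ.coact (b i) = b i ⊗ₜ AddMonoidAlgebra.single (χ i) (1 : k)) :
    ρ.IsWeightBasis b.dualBasis χ := by
  rw [isWeightBasis_iff]
  intro i
  refine LinearMap.congr_fun (f := contract (b.dualBasis i) _ ∘ₗ ρ.coact)
    (g := (b.dualBasis i).smulRight (AddMonoidAlgebra.single (χ i) (1 : k)))
    (b.ext fun j => ?_)
  rw [LinearMap.comp_apply, h, contract_tmul, LinearMap.smulRight_apply, b.dualBasis_apply_self]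
  split_ifs with hji
  · rw [hji]
  · rw [zero_smul, zero_smul]

theorem isWeightBasis_torusRep {ι : Type*} {ρ : LinRep k (AddMonoidAlgebra k A) V}
    {x : Module.Basis ι k (Module.Dual k V)} {χ : ι → A} (hx : ρ.IsWeightBasis x χ) :
    ρ.torusRep.IsWeightBasis x
      (fun i => QuotientAddGroup.mk' (AddCommGroup.torsion A) (χ i)) := by
  rw [isWeightBasis_iff] at hx ⊢
  intro i v
  rw [LinRep.torusRep, LinRep.res, LinearMap.comp_apply, contract_lTensor, hx, map_smul]
  congr 1
  exact AddMonoidAlgebra.mapDomainBialgHom_single _ _ _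

theorem mem_fixedSubspace_iff {ι : Type*} {ρ : LinRep k (AddMonoidAlgebra k A) V}
    {x : Module.Basis ι k (Module.Dual k V)} {χ : ι → A} (hx : ρ.IsWeightBasis x χ)
    (E : AddSubgroup A) (v : V) :
    v ∈ ρ.fixedSubspace (subgroupIdeal k E) ↔ ∀ i, χ i ∉ E → x i v = 0 := by
  set I := subgroupIdeal k E
  let q := (Ideal.Quotient.mkₐ k I).toLinearMap
  have h1 : v ∈ ρ.fixedSubspace I ↔ q.lTensor V (ρ.coact v) - v ⊗ₜ 1 = 0 := by
    rw [sub_eq_zero]; rfl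
  -- In the coordinate `x i`, the failure of `v` to be fixed is `x i v` times the class of `t^(χ i)
  -- - 1`, and this class vanishes exactly when `χ i ∈ E`.
  have h2 : ∀ i, contract (x i) _ (q.lTensor V (ρ.coact v) - v ⊗ₜ 1) =
      x i v • q (AddMonoidAlgebra.single (χ i) 1 - 1) := fun i => by
    have hq1 : q 1 = 1 := map_one (Ideal.Quotient.mk I)
    rw [map_sub, contract_lTensor, contract_tmul, isWeightBasis_iff.1 hx, map_smul, map_sub, hq1,
      smul_sub]
  have h3 : ∀ i, q (AddMonoidAlgebra.single (χ i) 1 - 1) = 0 ↔ χ i ∈ E := fun i => by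
    rw [← single_sub_one_mem_subgroupIdeal_iff (k := k)]
    exact Ideal.Quotient.eq_zero_iff_mem
  have h4 : v ∈ ρ.fixedSubspace I ↔
      ∀ i, contract (x i) _ (q.lTensor V (ρ.coact v) - v ⊗ₜ 1) = 0 :=
    h1.trans ⟨fun h i => by rw [h, map_zero], eq_zero_of_contract_eq_zero x _⟩
  rw [h4]
  refine forall_congr' fun i => ?_
  rw [h2, smul_eq_zero, h3]
  tauto

/-- If the action is faithful, the weights generate the character group. -/
theorem closure_weights_eq_top {ι : Type*} {ρ : LinRep k (AddMonoidAlgebra k A) V}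
    {x : Module.Basis ι k (Module.Dual k V)} {χ : ι → A} (hx : ρ.IsWeightBasis x χ)
    (hρ : ρ.IsFaithful) : AddSubgroup.closure (Set.range χ) = ⊤ := by
  set E := AddSubgroup.closure (Set.range χ)
  -- The subgroup scheme `D(A / E)` acts trivially, since no weight is outside `E`; by faithfulness
  -- it is trivial.
  have h := hρ (subgroupIdeal k E) (isHopfIdeal_subgroupIdeal E) (by
    rw [eq_top_iff]
    rintro v -
    rw [mem_fixedSubspace_iff hx]
    exact fun i hi => absurd (AddSubgroup.subset_closure (Set.mem_range_self i)) hi)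
  rw [eq_top_iff]
  rintro a -
  rw [← single_sub_one_mem_subgroupIdeal_iff (k := k), h, RingHom.mem_ker]
  simp

omit [FiniteDimensional k V] in
-- Expand the coaction of `v` along characters: the counit axiom says that `v` is the sum of the
-- components, and coassociativity says that each component is a weight vector.
theorem span_weightVectors (ρ : LinRep k (AddMonoidAlgebra k A) V) :
    Submodule.span k {v : V | ∃ a, ρ.coact v = v ⊗ₜ AddMonoidAlgebra.single a (1 : k)} = ⊤ := by
  classical
  have hdec : ∀ z : V ⊗[k] AddMonoidAlgebra k A, ∃ g : A →₀ V,
      z = g.sum fun a v => v ⊗ₜ AddMonoidAlgebra.single a (1 : k) := by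
    intro z
    induction z with
    | zero => exact ⟨0, by simp⟩
    | add y z hy hz =>
      obtain ⟨g, rfl⟩ := hy
      obtain ⟨h, rfl⟩ := hz
      refine ⟨g + h, ?_⟩
      rw [Finsupp.sum_add_index'] <;> simp [TensorProduct.add_tmul]
    | tmul v f =>
      induction f using AddMonoidAlgebra.induction_linear with
      | zero => exact ⟨0, by simp⟩
      | add y z hy hz =>
        obtain ⟨g, hg⟩ := hy
        obtain ⟨h, hh⟩ := hz
        refine ⟨g + h, ?_⟩
        rw [TensorProduct.tmul_add, hg, hh, Finsupp.sum_add_index'] <;>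
          simp [TensorProduct.add_tmul]
      | single a r =>
        refine ⟨Finsupp.single a (r • v), ?_⟩
        rw [Finsupp.sum_single_index (by simp), TensorProduct.smul_tmul]
        simp
  rw [eq_top_iff]
  rintro v -
  obtain ⟨g, hg⟩ := hdec (ρ.coact v)
  have hv : v = g.sum fun _ u => u := by
    have := ρ.counit_coact v
    rw [hg] at this
    rw [← this]
    simp [Finsupp.sum]
  rw [hv]
  refine Submodule.sum_mem _ fun b hb => Submodule.subset_span ⟨b, ?_⟩
  -- Extracting the coefficient of `t^b` in the last factor isolates the `b`-component on both sides
  -- of coassociativity.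
  let c : AddMonoidAlgebra k A ⊗[k] AddMonoidAlgebra k A →ₗ[k] AddMonoidAlgebra k A :=
    (TensorProduct.rid k _).toLinearMap ∘ₗ LinearMap.lTensor _
      (Finsupp.lapply b ∘ₗ (AddMonoidAlgebra.coeffLinearEquiv k).toLinearMap)
  have hc : ∀ (f : AddMonoidAlgebra k A) (a : A), c (f ⊗ₜ AddMonoidAlgebra.single a 1) =
      if a = b then f else 0 := fun f a => by
    by_cases h : a = b <;> simp [c, h]
  have h := congrArg (c.lTensor V) (ρ.coassoc v)
  rw [hg] at h
  have hl : ∀ (z : V ⊗[k] AddMonoidAlgebra k A) (a : A),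
      c.lTensor V (TensorProduct.assoc k V _ _ (z ⊗ₜ[k] AddMonoidAlgebra.single a (1 : k))) =
        if a = b then z else 0 := by
    intro z a
    induction z with
    | zero => simp
    | add y z hy hz => rw [TensorProduct.add_tmul, map_add, map_add, hy, hz]; split_ifs <;> simp
    | tmul u f =>
      rw [TensorProduct.assoc_tmul, LinearMap.lTensor_tmul, hc]
      split_ifs <;> simp
  have hr : ∀ (u : V) (a : A), c.lTensor V ((Coalgebra.comul (R := k)).lTensor V
      (u ⊗ₜ[k] AddMonoidAlgebra.single a (1 : k))) =
        if a = b then u ⊗ₜ AddMonoidAlgebra.single a (1 : k) else 0 := by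
    intro u a
    have : Coalgebra.comul (R := k) (AddMonoidAlgebra.single a (1 : k)) =
        AddMonoidAlgebra.single a (1 : k) ⊗ₜ[k] AddMonoidAlgebra.single a (1 : k) := by simp
    rw [LinearMap.lTensor_tmul, LinearMap.lTensor_tmul, this, hc]
    split_ifs <;> simp
  simp only [Finsupp.sum, map_sum, LinearMap.rTensor_tmul, hl, hr] at h
  rwa [Finset.sum_ite_eq_of_mem' _ _ _ hb, Finset.sum_ite_eq_of_mem' _ _ _ hb] at h

theorem exists_isWeightBasis (ρ : LinRep k (AddMonoidAlgebra k A) V) :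
    ∃ (n : ℕ) (x : Module.Basis (Fin n) k (Module.Dual k V)) (π : (Fin n →₀ ℕ) →+ A),
      ρ.IsWeightBasis x fun i => π (gen i) := by
  classical
  let b := Module.Basis.ofSpan (span_weightVectors ρ).ge
  have hb : ∀ i, ∃ a, ρ.coact (b i) = b i ⊗ₜ AddMonoidAlgebra.single a (1 : k) := fun i =>
    Module.Basis.ofSpan_subset (span_weightVectors ρ).ge ⟨i, rfl⟩
  let e := b.indexEquiv (Module.finBasis k V)
  choose χ hχ using hb
  refine ⟨_, (b.reindex e).dualBasis,
    Finsupp.liftAddHom fun i => multiplesHom A (χ (e.symm i)), ?_⟩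
  refine isWeightBasis_of_coact_basis _ _ fun i => ?_
  rw [Module.Basis.reindex_apply, hχ]
  simp [gen]

theorem isWeightBasis_diagonal {J : Type*} [Finite J] [DecidableEq J] (w : J → A) :
    (LinRep.diagonal k w).IsWeightBasis (Pi.basisFun k J).dualBasis w :=
  isWeightBasis_of_coact_basis _ _ fun _ => Module.Basis.constr_basis _ _ _ _

theorem basisFun_dualBasis_apply {J : Type*} [Finite J] [DecidableEq J] (j : J) :
    (Pi.basisFun k J).dualBasis j = LinearMap.proj j :=
  (Pi.basisFun k J).ext fun i => by
    rw [Module.Basis.dualBasis_apply_self]; simp [Pi.single_apply, eq_comm]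

end WeightBasis

/-! ### Pseudo-reflections of a diagonal action in terms of characters. -/

section PseudoReflections

variable {k A J : Type*} [Field k] [AddCommGroup A] [Finite J]

/-- The fixed space of `D(A / E)` is cut out by the coordinates with weight outside `E`, so its
codimension is their number. -/
theorem isPseudoReflection_diagonal_iff (w : J → A) (E : AddSubgroup A) :
    (LinRep.diagonal k w).IsPseudoReflection (subgroupIdeal k E) ↔ ∃! j, w j ∉ E := by
  classical
  have := Fintype.ofFinite J
  have hfix : (LinRep.diagonal k w).fixedSubspace (subgroupIdeal k E) =
      ⨅ j ∈ {j | w j ∉ E}, LinearMap.ker (LinearMap.proj j : (J → k) →ₗ[k] k) := by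
    ext v
    rw [mem_fixedSubspace_iff (isWeightBasis_diagonal w)]
    simp [basisFun_dualBasis_apply]
  have e := LinearMap.iInfKerProjEquiv k (fun _ : J => k) (I := {j | w j ∈ E})
    (J := {j | w j ∉ E}) (Set.disjoint_left.2 fun _ h h' => h' h)
    (fun j _ => by by_cases h : w j ∈ E <;> simp [h])
  have hdim : Module.finrank k ((LinRep.diagonal k w).fixedSubspace (subgroupIdeal k E)) =
      Fintype.card {j // w j ∈ E} := by
    rw [hfix, e.finrank_eq, Module.finrank_fintype_fun_eq_card]
    rfl
  have hcard := Fintype.card_subtype_compl fun j => w j ∈ E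
  have hle := Fintype.card_subtype_le fun j => w j ∈ E
  rw [LinRep.IsPseudoReflection, and_iff_right (isHopfIdeal_subgroupIdeal E), hdim,
    Module.finrank_fintype_fun_eq_card]
  have h1 : (∃! j, w j ∉ E) ↔ Fintype.card {j // w j ∉ E} = 1 := by
    rw [Fintype.card_eq_one_iff]
    constructor
    · rintro ⟨j, hj, h⟩; exact ⟨⟨j, hj⟩, fun y => Subtype.ext (h y y.2)⟩
    · rintro ⟨j, h⟩; exact ⟨j, j.2, fun y hy => congrArg Subtype.val (h ⟨y, hy⟩)⟩
  rw [h1]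
  omega

/-- Under the correspondence with subgroups of `A`, the subgroup scheme generated by the
pseudo-reflections is `D(A / N)`, where `N` is the intersection of all `E` that omit exactly one
weight. -/
theorem isGeneratedByPseudoReflections_diagonal_iff (w : J → A) :
    (LinRep.diagonal k w).IsGeneratedByPseudoReflections ↔
      ∀ a : A, (∀ E : AddSubgroup A, (∃! j, w j ∉ E) → a ∈ E) → a = 0 := by
  rw [LinRep.IsGeneratedByPseudoReflections, LinRep.pseudoReflectionIdeal]
  let N : AddSubgroup A := sInf {E | ∃! j, w j ∉ E}
  have hN : ∀ a, a ∈ N ↔ ∀ E : AddSubgroup A, (∃! j, w j ∉ E) → a ∈ E := fun a =>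
    AddSubgroup.mem_sInf
  simp_rw [← hN]
  constructor
  · intro h a ha
    have hle : subgroupIdeal k N ≤ ⊥ := by
      rw [← h]
      refine le_sSup ⟨isHopfIdeal_subgroupIdeal N, fun I hI => ?_⟩
      obtain ⟨E, rfl⟩ := exists_eq_subgroupIdeal I hI.1
      rw [subgroupIdeal_le_iff]
      exact sInf_le ((isPseudoReflection_diagonal_iff w E).1 hI)
    rw [← subgroupIdeal_bot, subgroupIdeal_le_iff] at hle
    exact hle ha
  · intro h
    rw [eq_bot_iff]
    refine sSup_le ?_
    rintro K ⟨hK, hle⟩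
    obtain ⟨E, rfl⟩ := exists_eq_subgroupIdeal K hK
    rw [← subgroupIdeal_bot, subgroupIdeal_le_iff]
    intro a ha
    refine h a ((hN a).2 fun D hD => ?_)
    exact (subgroupIdeal_le_iff (k := k) E D).1
      (hle _ ((isPseudoReflection_diagonal_iff w D).2 hD)) ha

end PseudoReflections

/-! ### MSOP in terms of integral relations -/

/-- Relations over `ℤ` between the weights `χ` of a diagonalizable group which express that `S`
is an MSOP basis for its torus. -/
def IsIntegralMSOP {ι A : Type*} [AddCommGroup A] (χ : ι → A) (S : Finset ι) : Prop :=
  (∀ z : ι → ℤ, ∑ i ∈ S, z i • χ i = 0 → ∀ i ∈ S, z i = 0) ∧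
  (∀ a, ∃ N : ℕ, 0 < N ∧ ∃ z : ι → ℤ, N • a = ∑ i ∈ S, z i • χ i) ∧
  ∀ j ∉ S, ∃ N : ℕ, 0 < N ∧ ∃ c : ι → ℕ, N • χ j + ∑ i ∈ S, c i • χ i = 0

section Integral

theorem exists_common_denominator {ι : Type*} [Finite ι] (q : ι → ℚ) :
    ∃ D : ℕ, 0 < D ∧ ∃ z : ι → ℤ, ∀ i, (D : ℚ) * q i = z i := by
  have := Fintype.ofFinite ι
  refine ⟨∏ i, (q i).den, Finset.prod_pos fun i _ => (q i).den_pos, ?_⟩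
  have : ∀ i, ∃ z : ℤ, ((∏ i, (q i).den : ℕ) : ℚ) * q i = z := fun i => by
    obtain ⟨c, hc⟩ := Finset.dvd_prod_of_mem (fun i => (q i).den) (Finset.mem_univ i)
    refine ⟨c * (q i).num, ?_⟩
    rw [hc]
    push_cast
    rw [mul_comm ((q i).den : ℚ), mul_assoc, mul_comm ((q i).den : ℚ), Rat.mul_den_eq_num]
  choose z hz using this
  exact ⟨z, hz⟩

variable {ι A W : Type*} [Finite ι] [AddCommGroup A] [AddCommGroup W] [Module ℚ W]

/-- Since `T` has torsion kernel and every vector has a positive multiple in its image, rational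
relations become integral after clearing denominators and multiplying once more to remove the
torsion error. -/
theorem isIntegralMSOP_iff_of_rationalization (T : A →+ W)
    (hker : ∀ a, T a = 0 → ∃ N : ℕ, 0 < N ∧ N • a = 0)
    (hrange : ∀ y, ∃ N : ℕ, 0 < N ∧ ∃ a, (N : ℚ) • y = T a) (χ : ι → A) (S : Finset ι) :
    IsIntegralMSOP χ S ↔
      LinearIndependent ℚ (fun i : S => T (χ i)) ∧
      Submodule.span ℚ (Set.range fun i : S => T (χ i)) = ⊤ ∧
      ∀ j ∉ S, ∃ c : ι → ℚ, (∀ i, c i ≤ 0) ∧ T (χ j) = ∑ i ∈ S, c i • T (χ i) := by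
  classical
  have hT : ∀ z : ι → ℤ, T (∑ i ∈ S, z i • χ i) = ∑ i ∈ S, (z i : ℚ) • T (χ i) := fun z => by
    rw [map_sum]
    exact Finset.sum_congr rfl fun i _ => by rw [map_zsmul, Int.cast_smul_eq_zsmul]
  have hTn : ∀ (N : ℕ) (a : A), T (N • a) = (N : ℚ) • T a := fun N a => by
    rw [map_nsmul, Nat.cast_smul_eq_nsmul]
  have hspan : ∀ y, y ∈ Submodule.span ℚ (Set.range fun i : S => T (χ i)) ↔
      ∃ c : ι → ℚ, y = ∑ i ∈ S, c i • T (χ i) := fun y => by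
    rw [Submodule.mem_span_range_iff_exists_fun]
    constructor
    · rintro ⟨c, rfl⟩
      refine ⟨fun i => if h : i ∈ S then c ⟨i, h⟩ else 0, ?_⟩
      rw [← Finset.sum_coe_sort S]
      exact Finset.sum_congr rfl fun i _ => by simp
    · rintro ⟨c, rfl⟩
      exact ⟨fun i => c i, Finset.sum_coe_sort S fun i => c i • T (χ i)⟩
  refine and_congr ?_ (and_congr ?_ ?_)
  · rw [Fintype.linearIndependent_iff]
    constructor
    · intro h c hc i
      obtain ⟨D, hD, z, hz⟩ := exists_common_denominator
        (fun i : ι => if h : i ∈ S then c ⟨i, h⟩ else 0)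
      have hz' : ∀ i : S, (D : ℚ) * c i = z i := fun i => by simpa using hz i
      have h0 : T (∑ i ∈ S, z i • χ i) = 0 := by
        rw [hT, ← Finset.sum_coe_sort S, ← smul_zero (D : ℚ), ← hc, Finset.smul_sum]
        exact Finset.sum_congr rfl fun i _ => by rw [← hz', mul_smul]
      obtain ⟨N, hN, h0⟩ := hker _ h0
      have := h (fun i => N * z i) (by
        rw [← h0, Finset.smul_sum]
        exact Finset.sum_congr rfl fun i _ => by
          rw [mul_smul, natCast_zsmul]) i i.2
      have hzi : z i = 0 := by
        rcases mul_eq_zero.1 this with h | h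
        · omega
        · exact h
      have := hz' i
      rw [hzi, Int.cast_zero] at this
      rcases mul_eq_zero.1 this with h | h
      · exact absurd (Nat.cast_eq_zero.1 h) hD.ne'
      · exact h
    · intro h z hz i hi
      have := h (fun i => z i) (by
        rw [Finset.sum_coe_sort S fun i => (z i : ℚ) • T (χ i), ← hT, hz, map_zero]) ⟨i, hi⟩
      exact_mod_cast this
  · rw [eq_top_iff]
    constructor
    · intro h y _
      obtain ⟨N, hN, a, ha⟩ := hrange y
      obtain ⟨N', hN', z, hz⟩ := h a
      rw [hspan]
      refine ⟨fun i => ((N' * N : ℕ) : ℚ)⁻¹ * z i, ?_⟩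
      simp_rw [mul_smul]
      rw [← Finset.smul_sum, ← hT, ← hz, hTn, ← ha, ← mul_smul (N' : ℚ), ← Nat.cast_mul,
        inv_smul_smul₀ (by positivity)]
    · intro h a
      obtain ⟨c, hc⟩ := (hspan _).1 (h (Submodule.mem_top (x := T a)))
      obtain ⟨D, hD, z, hz⟩ := exists_common_denominator c
      have h0 : T (D • a - ∑ i ∈ S, z i • χ i) = 0 := by
        rw [map_sub, hT, hTn, hc, Finset.smul_sum, sub_eq_zero]
        exact Finset.sum_congr rfl fun i _ => by rw [← hz, mul_smul]
      obtain ⟨N, hN, h0⟩ := hker _ h0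
      refine ⟨N * D, by positivity, fun i => N * z i, ?_⟩
      rw [smul_sub, sub_eq_zero, Finset.smul_sum] at h0
      rw [mul_smul, h0]
      exact Finset.sum_congr rfl fun i _ => by rw [mul_smul, natCast_zsmul]
  · refine forall_congr' fun j => forall_congr' fun _ => ?_
    constructor
    · rintro ⟨N, hN, c, hc⟩
      refine ⟨fun i => -((N : ℚ)⁻¹ * c i), fun i => neg_nonpos.2 (by positivity), ?_⟩
      have h := congrArg T hc
      rw [map_add, hTn, map_zero, map_sum, add_eq_zero_iff_eq_neg] at h
      have hN' : (N : ℚ) ≠ 0 := by positivity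
      rw [← inv_smul_smul₀ hN' (T (χ j)), h, smul_neg, Finset.smul_sum, ← Finset.sum_neg_distrib]
      exact Finset.sum_congr rfl fun i _ => by rw [hTn, neg_smul, mul_smul]
    · rintro ⟨c, hc0, hc⟩
      obtain ⟨D, hD, z, hz⟩ := exists_common_denominator c
      have hz0 : ∀ i, z i ≤ 0 := fun i => by
        have : (z i : ℚ) ≤ 0 := by
          rw [← hz]; exact mul_nonpos_of_nonneg_of_nonpos (by positivity) (hc0 i)
        exact_mod_cast this
      have h0 : T (D • χ j - ∑ i ∈ S, z i • χ i) = 0 := by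
        rw [map_sub, hT, hTn, hc, Finset.smul_sum, sub_eq_zero]
        exact Finset.sum_congr rfl fun i _ => by rw [← hz, mul_smul]
      obtain ⟨N, hN, h0⟩ := hker _ h0
      -- `D` clears denominators and `N` kills the torsion error; `toNat` loses nothing because `z i
      -- ≤ 0`.
      refine ⟨N * D, by positivity, fun i => N * (-z i).toNat, ?_⟩
      rw [mul_smul, ← h0, smul_sub, sub_eq_add_neg, ← smul_neg, ← Finset.sum_neg_distrib,
        Finset.smul_sum]
      congr 1
      refine Finset.sum_congr rfl fun i _ => ?_
      rw [mul_smul, ← neg_smul, ← natCast_zsmul (χ i) (-z i).toNat,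
        Int.toNat_of_nonneg (neg_nonneg.2 (hz0 i))]

theorem isMSOPBasis_torus_iff (χ : ι → A) (S : Finset ι) :
    IsMSOPBasis (fun i => QuotientAddGroup.mk' (AddCommGroup.torsion A) (χ i)) S ↔
      IsIntegralMSOP χ S := by
  let M := A ⧸ AddCommGroup.torsion A
  let T : A →+ ℚ ⊗[ℤ] M :=
    (TensorProduct.mk ℤ ℚ M 1).toAddMonoidHom.comp (QuotientAddGroup.mk' (AddCommGroup.torsion A))
  refine (isIntegralMSOP_iff_of_rationalization T ?_ ?_ χ S).symm
  · intro a ha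
    -- `ℚ ⊗ M` is the localization of `M` at the nonzero integers, so an element that dies there is
    -- killed by some nonzero `s`.
    obtain ⟨s, hs⟩ := (IsLocalizedModule.eq_zero_iff (nonZeroDivisors ℤ)
      (TensorProduct.mk ℤ ℚ M 1)).1 ha
    have hs' : ((s.1 • a : A) : M) = 0 := hs
    rw [QuotientAddGroup.eq_zero_iff, AddCommGroup.mem_torsion,
      isOfFinAddOrder_iff_nsmul_eq_zero] at hs'
    obtain ⟨n, hn, h⟩ := hs'
    have hs0 : s.1 ≠ 0 := nonZeroDivisors.ne_zero s.2
    refine ⟨n * s.1.natAbs, Nat.mul_pos hn (Int.natAbs_pos.2 hs0), ?_⟩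
    rcases Int.natAbs_eq s.1 with hs1 | hs1
    · rw [mul_smul, ← natCast_zsmul a, ← hs1, h]
    · rw [mul_smul, ← natCast_zsmul a, ← neg_neg ((s.1.natAbs : ℤ)), ← hs1, neg_smul, smul_neg, h,
        neg_zero]
  · intro y
    induction y with
    | zero => exact ⟨1, one_pos, 0, by simp⟩
    | add y z hy hz =>
      obtain ⟨N, hN, a, ha⟩ := hy
      obtain ⟨N', hN', a', ha'⟩ := hz
      refine ⟨N * N', by positivity, N' • a + N • a', ?_⟩
      rw [map_add, map_nsmul, map_nsmul, ← ha, ← ha', smul_add, ← Nat.cast_smul_eq_nsmul ℚ,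
        ← Nat.cast_smul_eq_nsmul ℚ, smul_smul, smul_smul, Nat.cast_mul, mul_comm (N : ℚ)]
    | tmul q m =>
      obtain ⟨a, rfl⟩ := QuotientAddGroup.mk_surjective m
      refine ⟨q.den, q.den_pos, q.num • a, ?_⟩
      rw [map_zsmul, TensorProduct.smul_tmul', smul_eq_mul, Rat.den_mul_eq_num]
      change _ = q.num • ((1 : ℚ) ⊗ₜ[ℤ] _)
      rw [TensorProduct.smul_tmul', zsmul_one]
      rfl

end Integral

/-! ### The face of an MSOP basis and the quotient by it. -/

section Face

variable {n : ℕ}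

theorem mem_msopFace_iff (S : Finset (Fin n)) (f : Fin n →₀ ℕ) :
    f ∈ msopFace S ↔ ∀ i ∉ S, f i = 0 := by
  classical
  rw [msopFace, faceGenerated, AddSubmonoid.mem_sInf]
  constructor
  · intro h
    refine h { carrier := {f | ∀ i ∉ S, f i = 0}
               zero_mem' := fun _ _ => rfl
               add_mem' := fun ha hb i hi => by
                rw [Finsupp.add_apply, ha i hi, hb i hi] } ⟨fun a b hab => ?_, ?_⟩
    · have h' : ∀ i ∉ S, a i + b i = 0 := hab
      exact ⟨fun i hi => by have := h' i hi; omega, fun i hi => by have := h' i hi; omega⟩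
    · rintro _ ⟨j, hj, rfl⟩ i hi
      exact Finsupp.single_eq_of_ne fun h => hi (h ▸ hj)
  · rintro h N ⟨-, hN⟩
    rw [← Finsupp.sum_single f]
    refine AddSubmonoid.sum_mem _ fun i hi => ?_
    have hiS : i ∈ S := by
      by_contra hc; exact Finsupp.mem_support_iff.1 hi (h i hc)
    have : Finsupp.single i (f i) = f i • gen i := by simp [gen]
    rw [this]
    exact AddSubmonoid.nsmul_mem _ (hN ⟨i, hiS, rfl⟩) _

theorem quotCon_msopFace_iff (S : Finset (Fin n)) (a b : Fin n →₀ ℕ) :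
    quotCon (msopFace S) a b ↔ ∀ j ∉ S, a j = b j := by
  classical
  constructor
  · rintro ⟨u, hu, v, hv, h⟩ j hj
    rw [mem_msopFace_iff] at hu hv
    have := DFunLike.congr_fun h j
    rwa [Finsupp.add_apply, Finsupp.add_apply, hu j hj, hv j hj, add_zero, add_zero] at this
  · intro h
    -- Each vector receives the `S`-part of the other, which makes the `S`-coordinates agree.
    refine ⟨b.filter (· ∈ S), ?_, a.filter (· ∈ S), ?_, ?_⟩
    · rw [mem_msopFace_iff]; exact fun i hi => Finsupp.filter_apply_neg _ _ hi
    · rw [mem_msopFace_iff]; exact fun i hi => Finsupp.filter_apply_neg _ _ hi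
    · ext j
      by_cases hj : j ∈ S
      · simp [hj, add_comm]
      · simp [hj, h j hj]

/-- The quotient of `ℕ^n` by the face generated by `S` is free on the remaining generators. -/
def quotEquiv (S : Finset (Fin n)) :
    ({j : Fin n // j ∉ S} →₀ ℕ) ≃+ (quotCon (msopFace S)).Quotient :=
  AddEquiv.ofBijective
    ((quotCon (msopFace S)).mk'.comp (Finsupp.mapDomain.addMonoidHom Subtype.val)) (by
    constructor
    · intro f g h
      have h' := (quotCon_msopFace_iff S _ _).1 ((AddCon.eq _).1 h)
      ext j
      have := h' j.1 j.2
      simpa [Finsupp.mapDomain_apply Subtype.val_injective] using this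
    · intro q
      obtain ⟨f, rfl⟩ := AddCon.mk'_surjective q
      refine ⟨f.subtypeDomain _, (AddCon.eq _).2 ((quotCon_msopFace_iff S _ _).2 fun j hj => ?_)⟩
      exact Finsupp.mapDomain_apply Subtype.val_injective (f.subtypeDomain _) ⟨j, hj⟩)

theorem quotEquiv_single (S : Finset (Fin n)) (j : {j : Fin n // j ∉ S}) :
    quotEquiv S (Finsupp.single j 1) = (quotCon (msopFace S)).mk' (gen j.1) :=
  congrArg (quotCon (msopFace S)).mk' Finsupp.mapDomain_single

end Face

/-! ### Invariant monomials modulo the MSOP face. -/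

section GpImage

variable {A : Type*} [AddCommGroup A] {n : ℕ}

theorem apply_eq_sum (π : (Fin n →₀ ℕ) →+ A) (f : Fin n →₀ ℕ) : π f = ∑ i, f i • π (gen i) := by
  conv_lhs => rw [← Finsupp.univ_sum_single f]
  rw [map_sum]
  refine Finset.sum_congr rfl fun i _ => ?_
  rw [← map_nsmul]; simp [gen]

theorem mem_gpImage_iff (π : (Fin n →₀ ℕ) →+ A) (S : Finset (Fin n)) (a : A) :
    a ∈ gpImage π (msopFace S) ↔ ∃ z : Fin n → ℤ, a = ∑ i ∈ S, z i • π (gen i) := by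
  constructor
  · intro h
    induction h using AddSubgroup.closure_induction with
    | mem a ha =>
      obtain ⟨f, hf, rfl⟩ := ha
      refine ⟨fun i => f i, ?_⟩
      rw [apply_eq_sum]
      simp_rw [natCast_zsmul]
      refine (Finset.sum_subset (Finset.subset_univ S) fun i _ hi => ?_).symm
      rw [(mem_msopFace_iff S f).1 hf i hi, zero_smul]
    | zero => exact ⟨0, by simp⟩
    | add a b _ _ ha hb =>
      obtain ⟨z, rfl⟩ := ha
      obtain ⟨y, rfl⟩ := hb
      exact ⟨z + y, by simp [add_smul, Finset.sum_add_distrib]⟩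
    | neg a _ ha =>
      obtain ⟨z, rfl⟩ := ha
      exact ⟨-z, by simp⟩
  · rintro ⟨z, rfl⟩
    refine AddSubgroup.sum_mem _ fun i hi => AddSubgroup.zsmul_mem _ ?_ _
    have hg : gen i ∈ msopFace S := (mem_msopFace_iff S _).2 fun j hj =>
      Finsupp.single_eq_of_ne fun h => hj (h ▸ hi)
    exact AddSubgroup.subset_closure ⟨gen i, hg, rfl⟩

theorem finite_quotient_gpImage [AddGroup.FG A] (π : (Fin n →₀ ℕ) →+ A) (S : Finset (Fin n))
    (hS : IsIntegralMSOP (fun i => π (gen i)) S) : Finite (A ⧸ gpImage π (msopFace S)) := by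
  refine AddCommGroup.finite_of_fg_isAddTorsion _ fun c => ?_
  obtain ⟨a, rfl⟩ := QuotientAddGroup.mk_surjective c
  obtain ⟨N, hN, z, hz⟩ := hS.2.1 a
  rw [isOfFinAddOrder_iff_nsmul_eq_zero]
  refine ⟨N, hN, ?_⟩
  rw [← QuotientAddGroup.mk_nsmul, QuotientAddGroup.eq_zero_iff, mem_gpImage_iff]
  exact ⟨z, hz⟩

/-- Independence of the weights in `S` makes the `S`-part of an invariant monomial unique.
Membership in `B` makes the required exponents integral, and the MSOP sign condition makes them
nonnegative. -/
theorem bijOn_quotCon_mk (π : (Fin n →₀ ℕ) →+ A) (S : Finset (Fin n))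
    (hS : IsIntegralMSOP (fun i => π (gen i)) S) :
    Set.BijOn (quotCon (msopFace S)).mk' {f | π f = 0}
      {q | quotHom π (msopFace S) q = 0} := by
  classical
  obtain ⟨hindep, -, hneg⟩ := hS
  have hq : ∀ f, quotHom π (msopFace S) ((quotCon (msopFace S)).mk' f) =
      ((π f : A) : A ⧸ gpImage π (msopFace S)) := fun f => rfl
  refine ⟨fun f hf => ?_, fun f hf g hg h => ?_, fun q hq0 => ?_⟩
  · have hf' : π f = 0 := hf
    change quotHom _ _ _ = 0
    rw [hq, hf', QuotientAddGroup.mk_zero]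
  · have h' := (quotCon_msopFace_iff S _ _).1 ((AddCon.eq _).1 h)
    have hfg : π f = π g := (show π f = 0 from hf).trans (show π g = 0 from hg).symm
    rw [apply_eq_sum, apply_eq_sum, ← sub_eq_zero, ← Finset.sum_sub_distrib] at hfg
    have := hindep (fun i => (f i : ℤ) - g i) (by
      rw [← hfg]
      refine (Finset.sum_subset (Finset.subset_univ S) fun i _ hi => ?_).trans
        (Finset.sum_congr rfl fun i _ => ?_)
      · simp [h' i hi]
      · rw [sub_smul, natCast_zsmul, natCast_zsmul])
    ext i
    by_cases hi : i ∈ S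
    · have := this i hi; omega
    · exact h' i hi
  · obtain ⟨f', rfl⟩ := AddCon.mk'_surjective q
    set f := f'.filter (· ∉ S) with hf
    have hff : (quotCon (msopFace S)).mk' f' = (quotCon (msopFace S)).mk' f :=
      (AddCon.eq _).2 ((quotCon_msopFace_iff S _ _).2 fun j hj => by simp [hf, hj])
    rw [hff] at hq0 ⊢
    have hB : ((π f : A) : A ⧸ gpImage π (msopFace S)) = 0 := hq0
    rw [QuotientAddGroup.eq_zero_iff, mem_gpImage_iff] at hB
    obtain ⟨z, hz⟩ := hB
    -- The sign condition passes from single weights off `S` to `π f`, being stable under sums and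
    -- multiples.
    have hN : ∃ N : ℕ, 0 < N ∧ ∃ c : Fin n → ℕ, N • π f + ∑ i ∈ S, c i • π (gen i) = 0 := by
      rw [apply_eq_sum]
      refine Finset.sum_induction _ (fun a => ∃ N : ℕ, 0 < N ∧ ∃ c : Fin n → ℕ,
        N • a + ∑ i ∈ S, c i • π (gen i) = 0) ?_ ⟨1, one_pos, 0, by simp⟩ ?_
      · rintro a b ⟨N, hN, c, hc⟩ ⟨N', hN', c', hc'⟩
        refine ⟨N * N', by positivity, N' • c + N • c', ?_⟩
        have : (N * N') • (a + b) + ∑ i ∈ S, (N' • c + N • c') i • π (gen i) =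
            N' • (N • a + ∑ i ∈ S, c i • π (gen i)) +
              N • (N' • b + ∑ i ∈ S, c' i • π (gen i)) := by
          simp only [Pi.add_apply, Pi.smul_apply, add_smul, Finset.sum_add_distrib, smul_add,
            Finset.smul_sum, smul_eq_mul, mul_smul, smul_comm N N' a]
          abel
        rw [this, hc, hc', smul_zero, smul_zero, add_zero]
      · intro i _
        by_cases hi : i ∈ S
        · exact ⟨1, one_pos, 0, by simp [hf, hi]⟩
        · obtain ⟨N, hN, c, hc⟩ := hneg i hi
          refine ⟨N, hN, f i • c, ?_⟩
          have : N • f i • π (gen i) + ∑ j ∈ S, (f i • c) j • π (gen j) =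
              f i • (N • π (gen i) + ∑ j ∈ S, c j • π (gen j)) := by
            simp only [smul_add, Finset.smul_sum, Pi.smul_apply, smul_eq_mul, mul_smul,
              smul_comm N (f i)]
          rw [this, hc, smul_zero]
    obtain ⟨N, hN, c, hc⟩ := hN
    have hz0 : ∀ i ∈ S, z i ≤ 0 := by
      intro i hi
      -- The two expressions for `π f` in the weights of `S` must agree, so `N * z i = -c i ≤ 0`.
      have := hindep (fun i => N * z i + c i) (by
        rw [← hc, hz, Finset.smul_sum, ← Finset.sum_add_distrib]
        exact Finset.sum_congr rfl fun i _ => by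
          rw [add_smul, mul_smul, natCast_zsmul, natCast_zsmul]) i hi
      have hNz : (N : ℤ) * z i ≤ 0 := by omega
      exact nonpos_of_mul_nonpos_right hNz (by exact_mod_cast hN)
    let g : Fin n →₀ ℕ := ∑ i ∈ S, (-z i).toNat • gen i
    have hg : ∀ j ∉ S, g j = 0 := fun j hj => by
      rw [Finsupp.finsetSum_apply]
      refine Finset.sum_eq_zero fun i hi => ?_
      have : i ≠ j := fun h => hj (h ▸ hi)
      simp [gen, this]
    refine ⟨f + g, ?_, (AddCon.eq _).2 ((quotCon_msopFace_iff S _ _).2 fun j hj => by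
      rw [Finsupp.add_apply, hg j hj, add_zero])⟩
    change π (f + g) = 0
    rw [map_add, hz, map_sum, ← Finset.sum_add_distrib]
    refine Finset.sum_eq_zero fun i hi => ?_
    rw [map_nsmul, ← natCast_zsmul, Int.toNat_of_nonneg (neg_nonneg.2 (hz0 i hi)), neg_smul,
      add_neg_cancel]

end GpImage

/-! ### Free monoids of invariant monomials -/

section Torus

variable {A : Type*} [AddCommGroup A] {n : ℕ}

theorem gpHom_apply (π : (Fin n →₀ ℕ) →+ A) (z : Fin n →₀ ℤ) :
    gpHom π z = ∑ i, z i • π (gen i) := by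
  simp [gpHom, Finsupp.sum_fintype]

/-- Each generator of a free monoid of invariant monomials has a coordinate which vanishes on all
the other generators. -/
theorem exists_coordinate (π : (Fin n →₀ ℕ) →+ A) {m : ℕ}
    (e : (Fin m →₀ ℕ) ≃+ AddMonoidHom.mker π) (l : Fin m) :
    ∃ i, (e (Finsupp.single l 1)).1 i ≠ 0 ∧
      ∀ l', l' ≠ l → (e (Finsupp.single l' 1)).1 i = 0 := by
  classical
  by_contra! hcon
  set p := fun l => (e (Finsupp.single l 1)).1 with hp
  -- If every coordinate of `p l` were shared, a multiple `N • e f` of the sum of the other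
  -- generators would dominate `p l`. The difference is again invariant, so `N • f` would involve
  -- the generator `l`, which is absent from `f`.
  let f : Fin m →₀ ℕ := ∑ l' ∈ Finset.univ.erase l, Finsupp.single l' 1
  have hf : f l = 0 := by
    rw [Finsupp.finsetSum_apply]
    exact Finset.sum_eq_zero fun l' hl' =>
      Finsupp.single_eq_of_ne (Finset.ne_of_mem_erase hl').symm
  have hef : (e f).1 = ∑ l' ∈ Finset.univ.erase l, p l' := by
    rw [map_sum, AddSubmonoid.coe_finsetSum]
  let N := ∑ i, p l i
  have hle : p l ≤ N • (e f).1 := by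
    intro i
    by_cases h0 : p l i = 0
    · rw [h0]; exact Nat.zero_le _
    · obtain ⟨l', hl', hi⟩ := hcon i h0
      have h1 : p l' i ≤ (e f).1 i := by
        rw [hef, Finsupp.finsetSum_apply]
        exact Finset.single_le_sum (f := fun l' => p l' i) (fun _ _ => Nat.zero_le _)
          (Finset.mem_erase.2 ⟨hl', Finset.mem_univ _⟩)
      have h2 : p l i ≤ N :=
        Finset.single_le_sum (f := fun i => p l i) (fun _ _ => Nat.zero_le _) (Finset.mem_univ i)
      have h3 : 1 ≤ (e f).1 i := (Nat.one_le_iff_ne_zero.2 hi).trans h1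
      calc p l i ≤ N * 1 := by rw [mul_one]; exact h2
        _ ≤ N * (e f).1 i := Nat.mul_le_mul_left _ h3
  obtain ⟨d, hd⟩ := exists_add_of_le hle
  have hd0 : π d = 0 := by
    have := congrArg π hd
    have h1 : π (p l) = 0 := (e (Finsupp.single l 1)).2
    have h2 : π (e f).1 = 0 := (e f).2
    rwa [map_nsmul, h2, smul_zero, map_add, h1, zero_add, eq_comm] at this
  have hs : N • f = Finsupp.single l 1 + e.symm ⟨d, hd0⟩ := by
    apply e.injective
    rw [map_nsmul, map_add, e.apply_symm_apply]
    exact Subtype.ext hd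
  have := DFunLike.congr_fun hs l
  rw [Finsupp.smul_apply, hf, Finsupp.add_apply, Finsupp.single_eq_same, smul_zero] at this
  omega

/-- If the monoid of invariant monomials is free and generates the lattice of invariant Laurent
monomials, then the torus has MSOP. -/
theorem exists_isIntegralMSOP (π : (Fin n →₀ ℕ) →+ A)
    (hgen : AddSubgroup.closure (Set.range fun i => π (gen i)) = ⊤)
    (hπ : IsPresentedByInvariants π) {m : ℕ} (e : (Fin m →₀ ℕ) ≃+ AddMonoidHom.mker π) :
    ∃ S : Finset (Fin n), IsIntegralMSOP (fun i => π (gen i)) S := by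
  classical
  choose c hc hc' using exists_coordinate π e
  set p := fun l => (e (Finsupp.single l 1)).1 with hp
  have hcinj : Function.Injective c := fun l l' h => by
    by_contra hne
    exact hc l (by rw [h]; exact hc' l' l hne)
  let S : Finset (Fin n) := Finset.univ \ Finset.univ.image c
  have hmemS : ∀ i, i ∉ S ↔ ∃ l, c l = i := fun i => by simp [S]
  have hpe : ∀ f, (e f).1 = ∑ l, f l • p l := fun f => by
    conv_lhs => rw [← Finsupp.univ_sum_single f]
    rw [map_sum, AddSubmonoid.coe_finsetSum]
    refine Finset.sum_congr rfl fun l _ => ?_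
    have : Finsupp.single l (f l) = f l • Finsupp.single l 1 := by simp
    rw [this, map_nsmul]
    rfl
  have hneg : ∀ j ∉ S, ∃ N : ℕ, 0 < N ∧ ∃ c : Fin n → ℕ,
      N • π (gen j) + ∑ i ∈ S, c i • π (gen i) = 0 := by
    intro j hj
    obtain ⟨l, rfl⟩ := (hmemS j).1 hj
    refine ⟨p l (c l), Nat.pos_of_ne_zero (hc l), p l, ?_⟩
    have h0 : π (p l) = 0 := (e (Finsupp.single l 1)).2
    rw [apply_eq_sum, ← Finset.sum_sdiff (Finset.subset_univ (Finset.univ.image c)),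
      Finset.sum_image fun _ _ _ _ h => hcinj h] at h0
    rw [Finset.sum_eq_single l (fun l' _ hl' => by rw [hc' l' l hl'.symm, zero_smul])
      (fun h => absurd (Finset.mem_univ l) h)] at h0
    rw [add_comm]
    exact h0
  refine ⟨S, fun z hz => ?_, fun a => ?_, hneg⟩
  · let y : Fin n →₀ ℤ := Finsupp.equivFunOnFinite.symm fun i => if i ∈ S then z i else 0
    have hy : ∀ i, y i = if i ∈ S then z i else 0 := fun i => rfl
    have hker : y ∈ (gpHom π).ker := by
      rw [AddMonoidHom.mem_ker, gpHom_apply, ← hz]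
      simp only [hy, ite_smul, zero_smul]
      rw [Finset.sum_ite_mem, Finset.univ_inter]
    rw [← hπ] at hker
    have hcomb : ∃ r : Fin m → ℤ, y = ∑ l, r l • toGp n (p l) := by
      clear_value y
      clear hy
      induction hker using AddSubgroup.closure_induction with
      | mem y hy =>
        obtain ⟨q, hq, rfl⟩ := hy
        obtain ⟨f, hf⟩ := e.surjective ⟨q, hq⟩
        refine ⟨fun l => f l, ?_⟩
        have : q = (e f).1 := by rw [hf]
        rw [this, hpe, map_sum]
        exact Finset.sum_congr rfl fun l _ => by rw [map_nsmul, natCast_zsmul]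
      | zero => exact ⟨0, by simp⟩
      | add a b _ _ ha hb =>
        obtain ⟨r, rfl⟩ := ha
        obtain ⟨s, rfl⟩ := hb
        exact ⟨r + s, by simp [add_smul, Finset.sum_add_distrib]⟩
      | neg a _ ha =>
        obtain ⟨r, rfl⟩ := ha
        exact ⟨-r, by simp⟩
    obtain ⟨r, hr⟩ := hcomb
    have hyi : ∀ i, y i = ∑ l, r l * (p l i : ℤ) := fun i => by
      rw [hr, Finsupp.finsetSum_apply]; rfl
    have hr0 : ∀ l, r l = 0 := fun l => by
      have h1 := hyi (c l)
      rw [hy, if_neg ((hmemS _).2 ⟨l, rfl⟩), Finset.sum_eq_single l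
        (fun l' _ hl' => by rw [show p l' (c l) = 0 from hc' l l' hl']; simp)
        (fun h => absurd (Finset.mem_univ l) h)] at h1
      rcases mul_eq_zero.1 h1.symm with h | h
      · exact h
      · exact absurd (Int.natCast_eq_zero.1 h) (hc l)
    intro i hi
    have := hyi i
    rw [hy, if_pos hi] at this
    rw [this]
    exact Finset.sum_eq_zero fun l _ => by rw [hr0, zero_mul]
  · have ha : a ∈ AddSubgroup.closure (Set.range fun i => π (gen i)) := by
      rw [hgen]; trivial
    induction ha using AddSubgroup.closure_induction with
    | mem a ha =>
      obtain ⟨i, rfl⟩ := ha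
      by_cases hi : i ∈ S
      · exact ⟨1, one_pos, Pi.single i 1, by
          simp [Pi.single_apply, ite_smul, hi]⟩
      · obtain ⟨N, hN, d, hd⟩ := hneg i hi
        refine ⟨N, hN, fun i => -d i, ?_⟩
        rw [eq_neg_of_add_eq_zero_left hd, ← Finset.sum_neg_distrib]
        exact Finset.sum_congr rfl fun i _ => by rw [neg_smul, natCast_zsmul]
    | zero => exact ⟨1, one_pos, 0, by simp⟩
    | add a b _ _ ha hb =>
      obtain ⟨N, hN, z, hz⟩ := ha
      obtain ⟨N', hN', z', hz'⟩ := hb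
      refine ⟨N * N', by positivity, N' • z + N • z', ?_⟩
      rw [smul_add, mul_smul N N' b, hz', mul_comm, mul_smul, hz]
      simp [add_smul, Finset.sum_add_distrib, Finset.smul_sum, mul_smul]
    | neg a _ ha =>
      obtain ⟨N, hN, z, hz⟩ := ha
      exact ⟨N, hN, -z, by simp [hz]⟩

end Torus

/-! ### Diagonal actions with a finite character group. -/

section FiniteGroup

variable {C J : Type*} [AddCommGroup C] (w : J → C) (p : (J →₀ ℕ) →+ C)

/-- The subgroup generated by all the weights but one. -/
def otherWeights (j : J) : AddSubgroup C :=
  AddSubgroup.closure (w '' {l | l ≠ j})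

variable {w p}

theorem mem_otherWeights {l j : J} (h : l ≠ j) : w l ∈ otherWeights w j :=
  AddSubgroup.subset_closure ⟨l, h, rfl⟩

/-- A subgroup omitting only `w j` contains `otherWeights w j`, which is itself such a subgroup
unless it contains `w j`; in that case it is everything and imposes no condition. -/
theorem forall_mem_iff_forall_mem_otherWeights
    (hgen : AddSubgroup.closure (Set.range w) = ⊤) (a : C) :
    (∀ E : AddSubgroup C, (∃! j, w j ∉ E) → a ∈ E) ↔ ∀ j, a ∈ otherWeights w j := by
  constructor
  · intro h j
    by_cases hj : w j ∈ otherWeights w j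
    · have : (⊤ : AddSubgroup C) ≤ otherWeights w j := by
        rw [← hgen, AddSubgroup.closure_le]
        rintro _ ⟨l, rfl⟩
        by_cases hl : l = j
        · rw [hl]; exact hj
        · exact mem_otherWeights hl
      exact this trivial
    · exact h _ ⟨j, hj, fun l hl => by_contra fun hne => hl (mem_otherWeights hne)⟩
  · rintro h E ⟨j, -, hj⟩
    refine (AddSubgroup.closure_le E).2 ?_ (h j)
    rintro _ ⟨l, hl, rfl⟩
    by_contra hc
    exact hl (hj l hc)

variable (hp : ∀ j, p (Finsupp.single j 1) = w j)

include hp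

theorem apply_single (j : J) (r : ℕ) : p (Finsupp.single j r) = r • w j := by
  rw [← hp, ← map_nsmul]; simp

theorem apply_eq_sum_weights [Fintype J] (q : J →₀ ℕ) : p q = ∑ j, q j • w j := by
  conv_lhs => rw [← Finsupp.univ_sum_single q]
  rw [map_sum]
  exact Finset.sum_congr rfl fun j _ => apply_single hp j _

theorem mk_apply [Finite J] (j : J) (q : J →₀ ℕ) :
    ((p q : C) : C ⧸ otherWeights w j) = q j • (w j : C ⧸ otherWeights w j) := by
  classical
  have := Fintype.ofFinite J
  rw [apply_eq_sum_weights hp, ← QuotientAddGroup.mk'_apply, map_sum,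
    Finset.sum_eq_single j (fun l _ hl => ?_) (fun h => absurd (Finset.mem_univ j) h), map_nsmul]
  · rfl
  · rw [map_nsmul, QuotientAddGroup.mk'_apply,
      (QuotientAddGroup.eq_zero_iff _).2 (mem_otherWeights hl), smul_zero]

/-- Modulo the other weights only the `j`-th term of `p q` survives, so the hypothesis makes
invariance a separate divisibility condition `d j ∣ q j` on each coordinate. The invariant monoid is
then a product of the monoids `d j ℕ`. -/
theorem exists_equiv_of_iInf_otherWeights [Finite J] [Finite C]
    (h : ∀ a, (∀ j, a ∈ otherWeights w j) → a = 0) :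
    ∃ m : ℕ, Nonempty ((Fin m →₀ ℕ) ≃+ AddMonoidHom.mker p) := by
  classical
  have := Fintype.ofFinite J
  let d : J → ℕ := fun j => addOrderOf (w j : C ⧸ otherWeights w j)
  have hd : ∀ j, 0 < d j := fun j => addOrderOf_pos _
  have hmem : ∀ q, p q = 0 ↔ ∀ j, d j ∣ q j := by
    intro q
    constructor
    · intro hq j
      rw [addOrderOf_dvd_iff_nsmul_eq_zero, ← mk_apply hp, hq, QuotientAddGroup.mk_zero]
    · intro hq
      rw [apply_eq_sum_weights hp]
      refine Finset.sum_eq_zero fun j _ => h _ fun l => ?_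
      by_cases hl : j = l
      · subst hl
        rw [← QuotientAddGroup.eq_zero_iff, QuotientAddGroup.mk_nsmul]
        exact addOrderOf_dvd_iff_nsmul_eq_zero.1 (hq j)
      · exact AddSubgroup.nsmul_mem _ (mem_otherWeights hl) _
  let g : (J →₀ ℕ) →+ AddMonoidHom.mker p :=
    { toFun := fun f => ⟨Finsupp.equivFunOnFinite.symm fun j => d j * f j,
        (hmem _).2 fun j => Dvd.intro _ rfl⟩
      map_zero' := Subtype.ext (Finsupp.ext fun j => mul_zero _)
      map_add' := fun f f' => Subtype.ext (Finsupp.ext fun j => mul_add _ _ _) }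
  have hg : Function.Bijective g := by
    constructor
    · intro f f' hff
      ext j
      exact Nat.eq_of_mul_eq_mul_left (hd j) (DFunLike.congr_fun (congrArg Subtype.val hff) j)
    · rintro ⟨q, hq⟩
      choose f hf using (hmem q).1 hq
      exact ⟨Finsupp.equivFunOnFinite.symm f, Subtype.ext (Finsupp.ext fun j => (hf j).symm)⟩
  exact ⟨Fintype.card J,
    ⟨(Finsupp.domCongr (Fintype.equivFin J).symm).trans (AddEquiv.ofBijective g hg)⟩⟩

/-- The pure powers `a j`, with exponent the order of `w j`, are atoms of the invariant monoid,
hence distinct members of its free basis. A multiple of any invariant monomial is a combination of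
them, and comparing basis coefficients gives the divisibility. -/
theorem addOrderOf_dvd_of_equiv [Finite J] [Finite C] {m : ℕ}
    (e : (Fin m →₀ ℕ) ≃+ AddMonoidHom.mker p) (q : J →₀ ℕ) (hq : p q = 0) (j : J) :
    addOrderOf (w j) ∣ q j := by
  classical
  have := Fintype.ofFinite J
  let o : J → ℕ := fun j => addOrderOf (w j)
  have ho : ∀ j, 0 < o j := fun j => addOrderOf_pos _
  have hker : ∀ j, p (Finsupp.single j (o j)) = 0 := fun j => by
    rw [apply_single hp, addOrderOf_nsmul_eq_zero]
  let a : J → AddMonoidHom.mker p := fun j => ⟨Finsupp.single j (o j), hker j⟩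
  have hatom : ∀ j, ∃ l, e.symm (a j) = Finsupp.single l 1 := by
    intro j
    have hne : e.symm (a j) ≠ 0 := fun h0 => by
      rw [map_eq_zero_iff _ e.symm.injective] at h0
      have := DFunLike.congr_fun (congrArg Subtype.val h0) j
      simp only [a, Finsupp.single_eq_same] at this
      exact (ho j).ne' this
    obtain ⟨l, hl⟩ := DFunLike.ne_iff.1 hne
    refine ⟨l, ?_⟩
    obtain ⟨r, hr⟩ : ∃ r, e.symm (a j) = Finsupp.single l 1 + r :=
      exists_add_of_le (Finsupp.single_le_iff.2 (Nat.one_le_iff_ne_zero.2 hl))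
    have hsum : Finsupp.single j (o j) = (e (Finsupp.single l 1)).1 + (e r).1 := by
      have := congrArg (fun f => (e f).1) hr
      simpa [a] using this
    have hvan : ∀ (x y : J →₀ ℕ), Finsupp.single j (o j) = x + y → x = Finsupp.single j (x j) := by
      intro x y hxy
      ext i
      by_cases hi : i = j
      · rw [hi, Finsupp.single_eq_same]
      · have := DFunLike.congr_fun hxy i
        rw [Finsupp.single_eq_of_ne hi, Finsupp.add_apply] at this
        rw [Finsupp.single_eq_of_ne hi]
        omega
    have hdvd : ∀ x : AddMonoidHom.mker p, x.1 = Finsupp.single j (x.1 j) → o j ∣ x.1 j := by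
      intro x hx
      have h0 : p x.1 = 0 := x.2
      rw [hx, apply_single hp] at h0
      exact addOrderOf_dvd_iff_nsmul_eq_zero.2 h0
    have h1 := hvan _ _ hsum
    have h2 := hvan _ _ (hsum.trans (add_comm _ _))
    have hx : e (Finsupp.single l 1) ≠ 0 := fun h0 => by
      rw [map_eq_zero_iff _ e.injective] at h0
      simp at h0
    have hxj : (e (Finsupp.single l 1)).1 j ≠ 0 := fun h0 => hx (Subtype.ext (by
      rw [h1, h0, Finsupp.single_zero]; rfl))
    -- The first summand is already a nonzero invariant power of the `j`-th variable, so its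
    -- exponent is at least `o j` and nothing remains for the second.
    have hle := Nat.le_of_dvd (Nat.pos_of_ne_zero hxj) (hdvd _ h1)
    have hj := DFunLike.congr_fun hsum j
    rw [Finsupp.single_eq_same, Finsupp.add_apply] at hj
    have hr0 : e r = 0 := Subtype.ext (by
      rw [h2, show (e r).1 j = 0 by omega, Finsupp.single_zero]; rfl)
    rw [hr, (map_eq_zero_iff _ e.injective).1 hr0, add_zero]
  choose l hl using hatom
  have hlinj : Function.Injective l := fun i j hij => by
    by_contra hne
    have h1 : a i = a j := e.symm.injective (by rw [hl, hl, hij])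
    have h2 := DFunLike.congr_fun (congrArg Subtype.val h1) i
    simp only [a] at h2
    rw [Finsupp.single_eq_same, Finsupp.single_eq_of_ne hne] at h2
    exact (ho i).ne' h2
  have hK : ∀ i, ∃ r, Nat.card C = o i * r := fun i => addOrderOf_dvd_natCard (w i)
  choose r hr using hK
  let x : AddMonoidHom.mker p := ⟨q, hq⟩
  -- Multiplication by `|C| = o i * r i` turns every exponent into a multiple of `o i`. The
  -- coefficient at `l j` then gives `o j * r j * (coefficient of x) = r j * q j`, and `r j`
  -- cancels.
  have hx : Nat.card C • x = ∑ i, (r i * q i) • a i := by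
    refine Subtype.ext (Finsupp.ext fun i => ?_)
    rw [AddSubmonoid.coe_finsetSum, Finsupp.finsetSum_apply, Finset.sum_eq_single i]
    · change Nat.card C * q i = (r i * q i) * (Finsupp.single i (o i)) i
      rw [Finsupp.single_eq_same, hr i]; ring
    · intro b _ hb
      change (r b * q b) * (Finsupp.single b (o b)) i = 0
      rw [Finsupp.single_eq_of_ne hb.symm, mul_zero]
    · exact fun h => absurd (Finset.mem_univ i) h
  have hy := congrArg (fun x => e.symm x (l j)) hx
  simp only [map_nsmul, map_sum, hl, Finsupp.smul_apply, Finsupp.finsetSum_apply] at hy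
  rw [Finset.sum_eq_single j (fun b _ hb => by
      rw [Finsupp.single_eq_of_ne fun h => hb (hlinj h).symm, smul_zero])
    (fun h => absurd (Finset.mem_univ j) h), Finsupp.single_eq_same, smul_eq_mul, smul_eq_mul,
    mul_one, hr j] at hy
  have hrpos : 0 < r j := Nat.pos_of_ne_zero fun h0 => by
    have := hr j
    rw [h0, mul_zero] at this
    exact Nat.card_pos.ne' this
  refine ⟨e.symm x (l j), Nat.eq_of_mul_eq_mul_left hrpos ?_⟩
  rw [← hy]; ring

/-- In a finite group `-c = (|C| - 1) • c`, so nonnegative exponents suffice to reach the whole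
generated subgroup. -/
theorem exists_apply_eq [Finite C] (s : Set J) (c : C) (hc : c ∈ AddSubgroup.closure (w '' s)) :
    ∃ b : J →₀ ℕ, (∀ j ∉ s, b j = 0) ∧ p b = c := by
  induction hc using AddSubgroup.closure_induction with
  | mem c hc =>
    obtain ⟨j, hj, rfl⟩ := hc
    exact ⟨Finsupp.single j 1, fun i hi => Finsupp.single_eq_of_ne fun h => hi (h ▸ hj), hp j⟩
  | zero => exact ⟨0, fun _ _ => rfl, map_zero p⟩
  | add c d _ _ hc hd =>
    obtain ⟨b, hb, rfl⟩ := hc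
    obtain ⟨b', hb', rfl⟩ := hd
    exact ⟨b + b', fun j hj => by rw [Finsupp.add_apply, hb j hj, hb' j hj], map_add p _ _⟩
  | neg c _ hc =>
    obtain ⟨b, hb, rfl⟩ := hc
    refine ⟨(Nat.card C - 1) • b, fun j hj => by rw [Finsupp.smul_apply, hb j hj, smul_zero], ?_⟩
    rw [map_nsmul, eq_neg_iff_add_eq_zero, ← succ_nsmul, Nat.sub_add_cancel Nat.card_pos]
    exact card_nsmul_eq_zero'

/-- For a finite character group generated by the weights, the monoid of invariant monomials is
free iff no nonzero character lies in every subgroup that contains all the weights but one. -/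
theorem exists_equiv_mker_iff [Finite J] [Finite C] (hgen : AddSubgroup.closure (Set.range w) = ⊤) :
    (∃ m : ℕ, Nonempty ((Fin m →₀ ℕ) ≃+ AddMonoidHom.mker p)) ↔
      ∀ a : C, (∀ E : AddSubgroup C, (∃! j, w j ∉ E) → a ∈ E) → a = 0 := by
  have := Fintype.ofFinite J
  simp_rw [forall_mem_iff_forall_mem_otherWeights hgen]
  refine ⟨?_, exists_equiv_of_iInf_otherWeights hp⟩
  rintro ⟨m, ⟨e⟩⟩ c hc
  obtain ⟨f, -, rfl⟩ := exists_apply_eq hp Set.univ c (by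
    rw [Set.image_univ, hgen]; trivial)
  rw [apply_eq_sum_weights hp]
  refine Finset.sum_eq_zero fun j _ => ?_
  -- Since `p f` lies in the span of the other weights, `f` can be completed to an invariant
  -- monomial without changing its `j`-th exponent; so the order of `w j` divides `f j`, and each
  -- term of `p f` vanishes.
  obtain ⟨b, hb, hbf⟩ := exists_apply_eq hp {l | l ≠ j} (-p f) (AddSubgroup.neg_mem _ (hc j))
  have h0 : p (f + b) = 0 := by rw [map_add, hbf, add_neg_cancel]
  have := addOrderOf_dvd_of_equiv hp e _ h0 j
  rw [Finsupp.add_apply, hb j (fun h => h rfl), add_zero] at this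
  exact addOrderOf_dvd_iff_nsmul_eq_zero.1 this

end FiniteGroup

/-! ### From monoids back to representations. -/

section Assembly

variable {k A V : Type*} [Field k] [AddCommGroup A] [AddCommGroup V] [Module k V]
  [FiniteDimensional k V] {n : ℕ}

omit [FiniteDimensional k V] in
theorem coordEquiv_ι (x : Module.Basis (Fin n) k (Module.Dual k V)) (i : Fin n) :
    coordEquiv x (SymmetricAlgebra.ι k _ (x i)) = AddMonoidAlgebra.single (gen i) 1 :=
  SymmetricAlgebra.equivMvPolynomial_ι_apply x i

theorem monoidCoact_coordEquiv {ρ : LinRep k (AddMonoidAlgebra k A) V}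
    {x : Module.Basis (Fin n) k (Module.Dual k V)} {π : (Fin n →₀ ℕ) →+ A}
    (hx : ρ.IsWeightBasis x fun i => π (gen i)) (f : CoordRing k V) :
    monoidCoact k π (coordEquiv x f) =
      Algebra.TensorProduct.map (coordEquiv x : _ →ₐ[k] _) (AlgHom.id k _) (ρ.coordCoact f) :=
  monoidCoact_apply_equiv hx π gen (fun _ => rfl) _ (coordEquiv_ι x) f

theorem degree_eq_zero {σ : Type*} (q : σ →₀ ℕ)
    (h : (Finsupp.degree : (σ →₀ ℕ) →+ ℕ) q = 0) : q = 0 :=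
  (Finsupp.degree_eq_zero_iff q).1 h

/-- If the invariants are polynomial and the characters are presented by the invariant monomials,
then the torus has MSOP. -/
theorem hasMSOP_of_isPolynomialAlgebra {ρ : LinRep k (AddMonoidAlgebra k A) V}
    {x : Module.Basis (Fin n) k (Module.Dual k V)} {π : (Fin n →₀ ℕ) →+ A}
    (hρ : ρ.IsFaithful) (hx : ρ.IsWeightBasis x fun i => π (gen i))
    (hπ : IsPresentedByInvariants π) (hpoly : IsPolynomialAlgebra k ρ.invariants) :
    HasMSOP ρ.torusRep := by
  rw [isPolynomialAlgebra_invariants_iff π (coordEquiv x) (monoidCoact_coordEquiv hx),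
    isPolynomialAlgebra_monoidInvariants_iff π Finsupp.degree degree_eq_zero] at hpoly
  obtain ⟨m, ⟨e⟩⟩ := hpoly
  obtain ⟨S, hS⟩ := exists_isIntegralMSOP π (closure_weights_eq_top hx hρ) hπ e
  exact ⟨n, x, _, S, isWeightBasis_torusRep hx, (isMSOPBasis_torus_iff _ S).2 hS⟩

theorem bijOn_toQuotAlg {ρ : LinRep k (AddMonoidAlgebra k A) V}
    {x : Module.Basis (Fin n) k (Module.Dual k V)} {π : (Fin n →₀ ℕ) →+ A}
    (hx : ρ.IsWeightBasis x fun i => π (gen i)) {S : Finset (Fin n)}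
    (hS : IsIntegralMSOP (fun i => π (gen i)) S) :
    Set.BijOn (toQuotAlg x (msopFace S)) ρ.invariants
      (monoidInvariants k (quotHom π (msopFace S))) := by
  refine Set.BijOn.comp (g := AddMonoidAlgebra.mapDomainAlgHom k k (quotCon (msopFace S)).mk')
    (f := coordEquiv x) (t := (monoidInvariants k π : Set (AddMonoidAlgebra k (Fin n →₀ ℕ))))
    (bijOn_monoidInvariants π _ (quotCon (msopFace S)).mk' (bijOn_quotCon_mk π S hS)) ?_
  have hmem := mem_invariants_iff π (coordEquiv x) (monoidCoact_coordEquiv hx)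
  refine ⟨fun f hf => (hmem f).1 hf, (coordEquiv x).injective.injOn, fun g hg => ?_⟩
  obtain ⟨f, rfl⟩ := (coordEquiv x).surjective g
  exact ⟨f, (hmem f).2 hg, rfl⟩

/-- Linear coordinates on the representation of the finite group scheme on the quotient of the
affine space by the MSOP face. -/
def quotCoordEquiv (k : Type*) [Field k] (S : Finset (Fin n)) :
    CoordRing k ({j : Fin n // j ∉ S} → k) ≃ₐ[k]
      AddMonoidAlgebra k (quotCon (msopFace S)).Quotient :=
  (SymmetricAlgebra.equivMvPolynomial (Pi.basisFun k {j : Fin n // j ∉ S}).dualBasis).trans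
    (AddMonoidAlgebra.domCongr k k (quotEquiv S))

theorem quotCoordEquiv_ι (S : Finset (Fin n)) (j : {j : Fin n // j ∉ S}) :
    quotCoordEquiv k S (SymmetricAlgebra.ι k _ ((Pi.basisFun k {j : Fin n // j ∉ S}).dualBasis j)) =
      AddMonoidAlgebra.single ((quotCon (msopFace S)).mk' (gen j.1)) 1 := by
  rw [quotCoordEquiv, AlgEquiv.trans_apply, SymmetricAlgebra.equivMvPolynomial_ι_apply,
    ← quotEquiv_single]
  exact AddMonoidAlgebra.domCongr_single _ _ _

theorem monoidCoact_quotCoordEquiv (π : (Fin n →₀ ℕ) →+ A) (S : Finset (Fin n))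
    (f : CoordRing k ({j : Fin n // j ∉ S} → k)) :
    monoidCoact k (quotHom π (msopFace S)) (quotCoordEquiv k S f) =
      Algebra.TensorProduct.map (quotCoordEquiv k S : _ →ₐ[k] _) (AlgHom.id k _)
        ((quotRep k π S).coordCoact f) :=
  monoidCoact_apply_equiv (ρ := quotRep k π S) (x := (Pi.basisFun k {j : Fin n // j ∉ S}).dualBasis)
    (χ := fun j => quotHom π (msopFace S) ((quotCon (msopFace S)).mk' (gen j.1)))
    (isWeightBasis_diagonal _) (quotHom π (msopFace S))
    (fun j => (quotCon (msopFace S)).mk' (gen j.1)) (fun _ => rfl) (quotCoordEquiv k S)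
    (quotCoordEquiv_ι S) f

theorem closure_quot_weights_eq_top {π : (Fin n →₀ ℕ) →+ A}
    (hgen : AddSubgroup.closure (Set.range fun i => π (gen i)) = ⊤) (S : Finset (Fin n)) :
    AddSubgroup.closure (Set.range fun j : {j : Fin n // j ∉ S} =>
      quotHom π (msopFace S) ((quotCon (msopFace S)).mk' (gen j.1))) = ⊤ := by
  have h := congrArg (AddSubgroup.map (QuotientAddGroup.mk' (gpImage π (msopFace S)))) hgen
  rw [AddMonoidHom.map_closure, AddSubgroup.map_top_of_surjective _
    (QuotientAddGroup.mk'_surjective _)] at h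
  rw [eq_top_iff, ← h, AddSubgroup.closure_le]
  rintro _ ⟨_, ⟨i, rfl⟩, rfl⟩
  by_cases hi : i ∈ S
  · have h0 : QuotientAddGroup.mk' (gpImage π (msopFace S)) (π (gen i)) = 0 := by
      rw [QuotientAddGroup.mk'_apply, QuotientAddGroup.eq_zero_iff, mem_gpImage_iff]
      exact ⟨Pi.single i 1, by simp [Pi.single_apply, ite_smul, hi]⟩
    simp only [h0]
    exact zero_mem _
  · exact AddSubgroup.subset_closure (Set.mem_range_self (⟨i, hi⟩ : {j : Fin n // j ∉ S}))

theorem isPolynomialAlgebra_iff_isGeneratedByPseudoReflections [AddGroup.FG A]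
    {ρ : LinRep k (AddMonoidAlgebra k A) V}
    {x : Module.Basis (Fin n) k (Module.Dual k V)} {π : (Fin n →₀ ℕ) →+ A}
    (hρ : ρ.IsFaithful) (hx : ρ.IsWeightBasis x fun i => π (gen i)) {S : Finset (Fin n)}
    (hS : IsIntegralMSOP (fun i => π (gen i)) S) :
    IsPolynomialAlgebra k ρ.invariants ↔ (quotRep k π S).IsGeneratedByPseudoReflections := by
  have := finite_quotient_gpImage π S hS
  -- The weight map on the free monoid of the coordinates off `S`; the equivalences `e` and `e'`
  -- identify its kernel with that of `π`, so the criterion for finite groups applies.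
  let p := (quotHom π (msopFace S)).comp (quotEquiv S).toAddMonoidHom
  have hp : ∀ j, p (Finsupp.single j 1) =
      quotHom π (msopFace S) ((quotCon (msopFace S)).mk' (gen j.1)) := fun j =>
    congrArg (quotHom π (msopFace S)) (quotEquiv_single S j)
  have hbij := bijOn_quotCon_mk π S hS
  let ψ : AddMonoidHom.mker p →+ AddMonoidHom.mker (quotHom π (msopFace S)) :=
    ((quotEquiv S).toAddMonoidHom.comp (AddMonoidHom.mker p).subtype).codRestrict _ fun q => q.2
  let ψ' : AddMonoidHom.mker π →+ AddMonoidHom.mker (quotHom π (msopFace S)) :=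
    ((quotCon (msopFace S)).mk'.comp (AddMonoidHom.mker π).subtype).codRestrict _
      fun q => hbij.mapsTo q.2
  let e : AddMonoidHom.mker p ≃+ AddMonoidHom.mker (quotHom π (msopFace S)) :=
    AddEquiv.ofBijective ψ ⟨fun a b h =>
      Subtype.ext ((quotEquiv S).injective (congrArg Subtype.val h)), fun b => by
        obtain ⟨a, ha⟩ := (quotEquiv S).surjective b.1
        have h0 : quotHom π (msopFace S) (quotEquiv S a) = 0 := by rw [ha]; exact b.2
        exact ⟨⟨a, h0⟩, Subtype.ext ha⟩⟩
  let e' : AddMonoidHom.mker π ≃+ AddMonoidHom.mker (quotHom π (msopFace S)) :=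
    AddEquiv.ofBijective ψ' ⟨fun a b h =>
      Subtype.ext (hbij.injOn a.2 b.2 (congrArg Subtype.val h)), fun b => by
        obtain ⟨a, ha, h⟩ := hbij.surjOn b.2
        exact ⟨⟨a, ha⟩, Subtype.ext h⟩⟩
  rw [isPolynomialAlgebra_invariants_iff π (coordEquiv x) (monoidCoact_coordEquiv hx),
    isPolynomialAlgebra_monoidInvariants_iff π Finsupp.degree degree_eq_zero, quotRep,
    isGeneratedByPseudoReflections_diagonal_iff,
    ← exists_equiv_mker_iff hp (closure_quot_weights_eq_top (closure_weights_eq_top hx hρ) S)]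
  exact exists_congr fun m => ⟨fun ⟨f⟩ => ⟨f.trans (e'.trans e.symm)⟩,
    fun ⟨f⟩ => ⟨f.trans (e.trans e'.symm)⟩⟩

end Assembly

end

end DiagonalizableCST

open DiagonalizableCST in
theorem mainTheorem6 {k A V : Type*} [Field k] [AddCommGroup A] [AddGroup.FG A]
    [AddCommGroup V] [Module k V] [FiniteDimensional k V]
    (ρ : LinRep k (AddMonoidAlgebra k A) V) (hρ : ρ.IsFaithful) :
    -- `k[V] = k[F']` with `F' = ℕ^n`, the action being induced from some `π : F' → A`
    (∃ (n : ℕ) (x : Module.Basis (Fin n) k (Module.Dual k V)) (π : (Fin n →₀ ℕ) →+ A),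
      ρ.IsWeightBasis x fun i => π (gen i)) ∧
    -- for every such presentation:
    ∀ (n : ℕ) (x : Module.Basis (Fin n) k (Module.Dual k V)) (π : (Fin n →₀ ℕ) →+ A),
      ρ.IsWeightBasis x (fun i => π (gen i)) →
      (IsPresentedByInvariants π → ¬ HasMSOP ρ.torusRep →
        ¬ IsPolynomialAlgebra k ρ.invariants) ∧
      ∀ S : Finset (Fin n),
        IsMSOPBasis (fun i => QuotientAddGroup.mk' (AddCommGroup.torsion A) (π (gen i))) S →
        Finite (A ⧸ gpImage π (msopFace S)) ∧
        -- the projection identifies `k[V]^G` with `k[F'/F'_0]^{D(A/B)}`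
        Set.BijOn (toQuotAlg x (msopFace S)) ρ.invariants
          (monoidInvariants k (quotHom π (msopFace S))) ∧
        -- `Spec k[F'/F'_0]` with its `D(A/B)`-action is the linear representation `quotRep k π S`
        (∃ Φ : CoordRing k ({j : Fin n // j ∉ S} → k) ≃ₐ[k]
              AddMonoidAlgebra k (quotCon (msopFace S)).Quotient,
          (∀ j, Φ (SymmetricAlgebra.ι k _ (LinearMap.proj j)) =
            AddMonoidAlgebra.single ((quotCon (msopFace S)).mk' (gen j.1)) 1) ∧
          ∀ f, monoidCoact k (quotHom π (msopFace S)) (Φ f) =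
            Algebra.TensorProduct.map (Φ : _ →ₐ[k] _) (AlgHom.id k _)
              ((quotRep k π S).coordCoact f)) ∧
        (IsPolynomialAlgebra k ρ.invariants ↔
          (quotRep k π S).IsGeneratedByPseudoReflections) := by
  refine ⟨exists_isWeightBasis ρ, fun n x π hx => ⟨fun hπ hT hpoly =>
    hT (hasMSOP_of_isPolynomialAlgebra hρ hx hπ hpoly), fun S hS => ?_⟩⟩
  rw [isMSOPBasis_torus_iff (fun i => π (gen i)) S] at hS
  refine ⟨finite_quotient_gpImage π S hS, bijOn_toQuotAlg hx hS,
    ⟨quotCoordEquiv k S, fun j => ?_, monoidCoact_quotCoordEquiv π S⟩,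
    isPolynomialAlgebra_iff_isGeneratedByPseudoReflections hρ hx hS⟩
  rw [← basisFun_dualBasis_apply]
  exact quotCoordEquiv_ι S j
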